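/- **Theorem 2.** Let $n\ge 1$ and $d=2^n$, and let $\mathbb M_d$ be the algebra of complex $d\times d$ matrices. All tensor products of two C*-algebras are maximal C*-tensor products, and infinite tensor products of matrix algebras are C*-inductive limits of finite ones along $a\mapsto a\otimes 1$. Let $\mathbf Q_n$ be the set of vectors $q=(q_1,\dots,q_d)$ of positive real numbers with $q_i^2\in\mathbb Q$ for all $i$ and $\sum_i q_i^2=1$, and for $q\in\mathbf Q_n$ put $|\phi_q\rangle=\sum_i q_i|ii\rangle\in\mathbb C^{d}\otimes\mathbb C^{d}$. Write $\langle\cdot\rangle_\phi=\langle\phi|\cdot|\phi\rangle$, let $s_\phi$ be the corresponding state on $\mathbb M_d\otimes\mathbb M_d$, and let $s_0=\langle 0|\cdot|0\rangle$ on $\mathbb M_d$. Let $$\mathcal M=\bigotimes_{q\in\mathbf Q_n}\bigotimes_{j\in\mathbb Z}\mathbb M_d ,$$ and for $m\in\mathbb M_d$ let $m^{(q,j)}\in\mathcal M$ be the copy of $m$ in the factor $(q,j)$. Then: 1. $\mathbf Q_n$ is countable, and it is dense in the set of all unit vectors of $\mathbb R^d$ with nonnegative entries. The set $D_n=\{(U\otimes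 V)|\phi_q\rangle : q\in\mathbf Q_n,\ U,V\in\mathbb M_d \text{ unitary}\}$ is a dense subset of the unit sphere of $\mathbb C^{2^n}\otimes\mathbb C^{2^n}$. 2. $\mathcal M$ and $\mathcal M\otimes\mathcal M$ are both $*$-isomorphic to the CAR algebra $\bigotimes_{k\in\mathbb N}\mathbb M_2$. 3. There is a state $s$ on $\mathcal M\otimes\mathcal M$ (the catalyst; the first factor is Alice's algebra and the second is Bob's) which is the infinite product of $\langle\cdot\rangle_{|00\rangle}$ at the sites $(q,j)$ with $j\le 0$ and of $\langle\cdot\rangle_{\phi_q}$ at the sites $(q,j)$ with $j\ge 1$; that is, for every finite set $F$ of sites and all $m_x,m_x'\in\mathbb M_d$ $(x\in F)$, $$s\Big(\prod_{x\in F}m_x^{(x)}\otimes\prod_{x\in F}m_x'^{(x)}\Big)=\prod_{x=(q,j)\in F,\ j\le 0}\langle m_x\otimes m_x'\rangle_{|00\rangle}\prod_{x=(q,j)\in F,\ j\ge 1}\langle m_x\otimes m_x'\rangle_{\phi_q}.$$ 4. For every $q\in\mathbf Q_n$ there are a $*$-automorphism $\sigma_q$ of $\mathcal M$ (the $n$-qubit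 shift) with $\sigma_q(m^{(q,j)})=m^{(q,j+1)}$ for all $j$ and $\sigma_q(m^{(p,j)})=m^{(p,j)}$ for all $p\ne q$ and all $j$, and a $*$-automorphism $\tau_q$ of $\mathcal M\otimes\mathbb M_d$ (the $n$-qubit swap) with $\tau_q(m^{(q,0)}\otimes 1)=1\otimes m$, $\tau_q(1\otimes m)=m^{(q,0)}\otimes 1$ and $\tau_q(m^{(x)}\otimes 1)=m^{(x)}\otimes 1$ for every site $x\ne(q,0)$. The $*$-automorphism $\alpha_q=(\sigma_q\otimes\mathrm{id})\circ\tau_q$ of $\mathcal M\otimes\mathbb M_d$ exactly embezzles $|\phi_q\rangle$: up to the canonical reordering of tensor factors, $$(s\otimes s_0\otimes s_0)\big((\alpha_q\otimes\alpha_q)(X)\big)=(s\otimes s_{\phi_q})(X)\qquad\text{for all }X\in(\mathcal M\otimes\mathbb M_d)\otimes(\mathcal M\otimes\mathbb M_d).$$ More generally, for all unitaries $U,V\in\mathbb M_d$, the state $|\phi\rangle=(U\otimes V)|\phi_q\rangle$ is exactly embezzled from the same catalyst $s$: with $\alpha=\alpha_q\circ(\mathrm{id}\otimes\mathrm{Ad}_{U^*})$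 for Alice and $\beta=\alpha_q\circ(\mathrm{id}\otimes\mathrm{Ad}_{V^*})$ for Bob, where $\mathrm{Ad}_{W}(m)=WmW^*$, one has $(s\otimes s_0\otimes s_0)((\alpha\otimes\beta)(X))=(s\otimes s_\phi)(X)$ for all $X$. Thus the single state $s$ allows exact embezzlement of every state in the dense set $D_n$. -/

import Mathlib

open scoped ComplexOrder TensorProduct

set_option linter.unusedSectionVars false

noncomputable section

/-! ### Completion of a unital `*`-algebra with respect to a C*-seminorm -/

/-- A C*-seminorm on a unital complex `*`-algebra. -/
structure CStarSeminorm (R : Type*) [Ring R] [StarRing R] [Algebra ℂ R] where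
  /-- the underlying function -/
  toFun : R → ℝ
  nonneg : ∀ x, 0 ≤ toFun x
  add_le : ∀ x y, toFun (x + y) ≤ toFun x + toFun y
  smul_eq : ∀ (c : ℂ) x, toFun (c • x) = ‖c‖ * toFun x
  mul_le : ∀ x y, toFun (x * y) ≤ toFun x * toFun y
  star_mul_self : ∀ x, toFun (star x * x) = toFun x * toFun x

namespace CStarSeminorm

section Basic

variable {R : Type*} [Ring R] [StarRing R] [Algebra ℂ R]

theorem zero_eq (p : CStarSeminorm R) : p.toFun 0 = 0 := by
  simpa using p.smul_eq 0 0

theorem le_star (p : CStarSeminorm R) (x : R) : p.toFun x ≤ p.toFun (star x) := by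
  rcases (p.nonneg x).eq_or_lt with h | h
  · rw [← h]; exact p.nonneg _
  · have := p.mul_le (star x) x
    rw [p.star_mul_self] at this
    exact le_of_mul_le_mul_right this h

theorem star_eq (p : CStarSeminorm R) (x : R) : p.toFun (star x) = p.toFun x :=
  le_antisymm (by simpa using p.le_star (star x)) (p.le_star x)

/-- The `*`-algebra `R` regarded as a seminormed ring through `p`. -/
def Pre (_p : CStarSeminorm R) : Type _ := R

instance (p : CStarSeminorm R) : Ring p.Pre := inferInstanceAs (Ring R)
instance (p : CStarSeminorm R) : StarRing p.Pre := inferInstanceAs (StarRing R)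
instance (p : CStarSeminorm R) : Algebra ℂ p.Pre := inferInstanceAs (Algebra ℂ R)
instance (p : CStarSeminorm R) [StarModule ℂ R] : StarModule ℂ p.Pre :=
  inferInstanceAs (StarModule ℂ R)

instance (p : CStarSeminorm R) : Norm p.Pre := ⟨p.toFun⟩

theorem core (p : CStarSeminorm R) : SeminormedSpace.Core ℂ p.Pre where
  norm_nonneg := p.nonneg
  norm_smul := p.smul_eq
  norm_triangle := p.add_le

instance (p : CStarSeminorm R) : SeminormedRing p.Pre where
  __ := (inferInstance : Ring p.Pre)
  __ := SeminormedAddCommGroup.ofCore p.core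
  norm_mul_le := p.mul_le

theorem norm_pre (p : CStarSeminorm R) (x : p.Pre) : ‖x‖ = p.toFun x := rfl

instance (p : CStarSeminorm R) : NormedAlgebra ℂ p.Pre where
  norm_smul_le c x := (p.smul_eq c x).le

instance (p : CStarSeminorm R) : NormedStarGroup p.Pre where
  norm_star_le x := (p.star_eq x).le

end Basic

section Completion

open UniformSpace

variable {R : Type*} [Ring R] [StarRing R] [Algebra ℂ R] [StarModule ℂ R]

/-- The C*-algebra obtained from `R` by dividing out the kernel of `p` and completing. -/
def Compl (p : CStarSeminorm R) : Type _ := Completion p.Pre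

namespace Compl

variable (p : CStarSeminorm R)

instance : NormedRing p.Compl := inferInstanceAs (NormedRing (Completion p.Pre))
instance : CompleteSpace p.Compl := inferInstanceAs (CompleteSpace (Completion p.Pre))
instance : Algebra ℂ p.Compl := inferInstanceAs (Algebra ℂ (Completion p.Pre))

instance : NormedAlgebra ℂ p.Compl where
  norm_smul_le c x := norm_smul_le (β := Completion p.Pre) c x

/-- The canonical map from `R`. -/
def of (x : R) : p.Compl := Completion.coe' (α := p.Pre) x

theorem norm_of (x : R) : ‖of p x‖ = p.toFun x := Completion.norm_coe (E := p.Pre) x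

theorem denseRange_of : DenseRange (of p) := Completion.denseRange_coe (α := p.Pre)

theorem of_add (x y : R) : of p (x + y) = of p x + of p y := Completion.coe_add (α := p.Pre) x y
theorem of_mul (x y : R) : of p (x * y) = of p x * of p y := Completion.coe_mul (α := p.Pre) x y
theorem of_one : of p 1 = 1 := Completion.coe_one p.Pre
theorem of_zero : of p 0 = 0 := Completion.coe_zero (α := p.Pre)
theorem of_smul (c : ℂ) (x : R) : of p (c • x) = c • of p x := Completion.coe_smul (X := p.Pre) c x

instance : Star p.Compl := ⟨Completion.map (star : p.Pre → p.Pre)⟩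

theorem uniformContinuous_star_pre : UniformContinuous (star : p.Pre → p.Pre) :=
  (starₗᵢ ℂ (E := p.Pre)).isometry.uniformContinuous

theorem of_star (x : R) : of p (star x) = star (of p x) :=
  (Completion.map_coe (uniformContinuous_star_pre p) x).symm

instance : ContinuousStar p.Compl :=
  ⟨Completion.continuous_map (f := (star : p.Pre → p.Pre))⟩

theorem ext_of {C : Type*} [TopologicalSpace C] [T2Space C] {f g : p.Compl → C}
    (hf : Continuous f) (hg : Continuous g) (h : ∀ x, f (of p x) = g (of p x)) (x : p.Compl) :
    f x = g x :=
  (denseRange_of p).induction_on x (isClosed_eq hf hg) h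

theorem ext_of₂ {C : Type*} [TopologicalSpace C] [T2Space C] {f g : p.Compl → p.Compl → C}
    (hf : Continuous fun z : p.Compl × p.Compl => f z.1 z.2)
    (hg : Continuous fun z : p.Compl × p.Compl => g z.1 z.2)
    (h : ∀ x y, f (of p x) (of p y) = g (of p x) (of p y)) (x y : p.Compl) :
    f x y = g x y :=
  (denseRange_of p).induction_on₂ (isClosed_eq hf hg) h x y

instance : StarRing p.Compl where
  star_involutive := ext_of p (f := fun x => star (star x)) (g := fun x => x)
    (by fun_prop) (by fun_prop) fun x => by rw [← of_star, ← of_star, star_star]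
  star_mul := ext_of₂ p (f := fun x y => star (x * y)) (g := fun x y => star y * star x)
    (by fun_prop) (by fun_prop) fun x y => by
      rw [← of_mul, ← of_star, ← of_star, ← of_star, ← of_mul, star_mul]
  star_add := ext_of₂ p (f := fun x y => star (x + y)) (g := fun x y => star x + star y)
    (by fun_prop) (by fun_prop) fun x y => by
      rw [← of_add, ← of_star, ← of_star, ← of_star, ← of_add, star_add]

theorem star_smul_compl (c : ℂ) (x : p.Compl) : star (c • x) = star c • star x := by
  have h1 : Continuous fun x : p.Compl => star (c • x) :=
    ContinuousStar.continuous_star.comp (continuous_const_smul c)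
  have h2 : Continuous fun x : p.Compl => star c • star x :=
    ContinuousStar.continuous_star.const_smul (star c)
  refine ext_of p h1 h2 (fun x => ?_) x
  rw [← of_smul, ← of_star, ← of_star, ← of_smul, star_smul]

instance : StarModule ℂ p.Compl := ⟨star_smul_compl p⟩

instance : CStarRing p.Compl where
  norm_mul_self_le x := by
    refine le_of_eq (ext_of p (f := fun x => ‖x‖ * ‖x‖) (g := fun x => ‖star x * x‖)
      (by fun_prop) (by fun_prop) (fun x => ?_) x)
    rw [← of_star, ← of_mul, norm_of, norm_of, p.star_mul_self]

instance : CStarAlgebra p.Compl where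

/-- The canonical `*`-homomorphism from `R`. -/
def ofHom : R →⋆ₐ[ℂ] p.Compl where
  toFun := of p
  map_one' := of_one p
  map_mul' := of_mul p
  map_zero' := of_zero p
  map_add' := of_add p
  commutes' c := by
    rw [Algebra.algebraMap_eq_smul_one, Algebra.algebraMap_eq_smul_one, of_smul, of_one]
  map_star' := of_star p

variable {C : Type*} [CStarAlgebra C]

theorem uniformContinuous_of_le (f : R →⋆ₐ[ℂ] C) (hf : ∀ x, ‖f x‖ ≤ p.toFun x) :
    UniformContinuous (α := p.Pre) (f : R → C) :=
  AddMonoidHomClass.uniformContinuous_of_bound (𝓕 := p.Pre →+ C) (f : R →+ C) 1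
    fun x => by rw [one_mul]; exact hf x

/-- A `*`-homomorphism from `R` that is bounded by `p` extends to the completion. -/
def liftFun (f : R →⋆ₐ[ℂ] C) : p.Compl → C := Completion.extension (α := p.Pre) (f : R → C)

theorem continuous_liftFun (f : R →⋆ₐ[ℂ] C) : Continuous (liftFun p f) :=
  Completion.continuous_extension (α := p.Pre)

theorem liftFun_of (f : R →⋆ₐ[ℂ] C) (hf : ∀ x, ‖f x‖ ≤ p.toFun x) (x : R) :
    liftFun p f (of p x) = f x :=
  Completion.extension_coe (uniformContinuous_of_le p f hf) x

/-- A `*`-homomorphism from `R` that is bounded by `p` extends to the completion. -/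
def lift (f : R →⋆ₐ[ℂ] C) (hf : ∀ x, ‖f x‖ ≤ p.toFun x) : p.Compl →⋆ₐ[ℂ] C where
  toFun := liftFun p f
  map_one' := by rw [← of_one, liftFun_of p f hf, map_one]
  map_mul' := by
    have hF := continuous_liftFun p f
    refine ext_of₂ p (f := fun x y => liftFun p f (x * y))
      (g := fun x y => liftFun p f x * liftFun p f y) (by fun_prop) (by fun_prop) fun x y => ?_
    rw [← of_mul, liftFun_of p f hf, liftFun_of p f hf, liftFun_of p f hf, map_mul]
  map_zero' := by rw [← of_zero, liftFun_of p f hf, map_zero]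
  map_add' := by
    have hF := continuous_liftFun p f
    refine ext_of₂ p (f := fun x y => liftFun p f (x + y))
      (g := fun x y => liftFun p f x + liftFun p f y) (by fun_prop) (by fun_prop) fun x y => ?_
    rw [← of_add, liftFun_of p f hf, liftFun_of p f hf, liftFun_of p f hf, map_add]
  commutes' c := by
    rw [Algebra.algebraMap_eq_smul_one, Algebra.algebraMap_eq_smul_one, ← of_one, ← of_smul,
      liftFun_of p f hf, map_smul, map_one]
  map_star' := by
    have hF := continuous_liftFun p f
    refine ext_of p (f := fun x => liftFun p f (star x)) (g := fun x => star (liftFun p f x))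
      (by fun_prop) (by fun_prop) fun x => ?_
    rw [← of_star, liftFun_of p f hf, liftFun_of p f hf, map_star]

theorem lift_of (f : R →⋆ₐ[ℂ] C) (hf : ∀ x, ‖f x‖ ≤ p.toFun x) (x : R) :
    lift p f hf (of p x) = f x :=
  liftFun_of p f hf x

end Compl

/-- The C*-seminorm obtained by pulling back the norm along a `*`-homomorphism. -/
def comap {C : Type*} [CStarAlgebra C] (f : R →⋆ₐ[ℂ] C) : CStarSeminorm R where
  toFun x := ‖f x‖
  nonneg x := norm_nonneg _
  add_le x y := by rw [map_add]; exact norm_add_le _ _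
  smul_eq c x := by rw [map_smul, norm_smul]
  mul_le x y := by rw [map_mul]; exact norm_mul_le _ _
  star_mul_self x := by rw [map_mul, map_star, CStarRing.norm_star_mul_self]

end Completion

end CStarSeminorm

/-! ### The maximal C*-tensor product -/

section MaxTensor

variable (A B : Type*) [CStarAlgebra A] [CStarAlgebra B]

variable {A B} in
/-- Every C*-seminorm on the algebraic tensor product is a subcross seminorm. -/
theorem CStarSeminorm.tmul_le (p : CStarSeminorm (A ⊗[ℂ] B)) (a : A) (b : B) :
    p.toFun (a ⊗ₜ b) ≤ ‖a‖ * ‖b‖ := by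
  let jA : A →⋆ₐ[ℂ] A ⊗[ℂ] B :=
    { Algebra.TensorProduct.includeLeft (R := ℂ) (S := ℂ) (A := A) (B := B) with
      map_star' := fun x => by simp [TensorProduct.star_tmul] }
  let jB : B →⋆ₐ[ℂ] A ⊗[ℂ] B :=
    { Algebra.TensorProduct.includeRight (R := ℂ) (A := A) (B := B) with
      map_star' := fun x => by simp [TensorProduct.star_tmul] }
  have h1 : p.toFun (a ⊗ₜ 1) ≤ ‖a‖ := by
    have := NonUnitalStarAlgHom.norm_apply_le ((Compl.ofHom p).comp jA) a
    rwa [← Compl.norm_of]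
  have h2 : p.toFun (1 ⊗ₜ b) ≤ ‖b‖ := by
    have := NonUnitalStarAlgHom.norm_apply_le ((Compl.ofHom p).comp jB) b
    rwa [← Compl.norm_of]
  have h3 : (a ⊗ₜ[ℂ] b : A ⊗[ℂ] B) = (a ⊗ₜ 1) * (1 ⊗ₜ b) := by simp
  rw [h3]
  exact (p.mul_le _ _).trans (mul_le_mul h1 h2 (p.nonneg _) (norm_nonneg _))

variable {A B} in
theorem CStarSeminorm.bddAbove (x : A ⊗[ℂ] B) :
    BddAbove (Set.range fun p : CStarSeminorm (A ⊗[ℂ] B) => p.toFun x) := by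
  induction x with
  | zero => exact ⟨0, by rintro _ ⟨p, rfl⟩; exact p.zero_eq.le⟩
  | tmul a b => exact ⟨‖a‖ * ‖b‖, by rintro _ ⟨p, rfl⟩; exact p.tmul_le a b⟩
  | add x y hx hy =>
    obtain ⟨c, hc⟩ := hx
    obtain ⟨d, hd⟩ := hy
    exact ⟨c + d, by
      rintro _ ⟨p, rfl⟩
      exact (p.add_le x y).trans (add_le_add (hc ⟨p, rfl⟩) (hd ⟨p, rfl⟩))⟩

instance CStarSeminorm.instNonempty (R : Type*) [Ring R] [StarRing R] [Algebra ℂ R] :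
    Nonempty (CStarSeminorm R) :=
  ⟨{ toFun := fun _ => 0, nonneg := by simp, add_le := by simp, smul_eq := by simp,
     mul_le := by simp, star_mul_self := by simp }⟩

/-- The maximal C*-norm on the algebraic tensor product `A ⊗ B`: the supremum of all
C*-seminorms, that is, of all the `‖π(x)‖` with `π` a `*`-representation of `A ⊗ B`. -/
def maxCStarNorm : CStarSeminorm (A ⊗[ℂ] B) where
  toFun x := ⨆ p : CStarSeminorm (A ⊗[ℂ] B), p.toFun x
  nonneg x := Real.iSup_nonneg fun q : CStarSeminorm (A ⊗[ℂ] B) => q.nonneg x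
  add_le x y := ciSup_le fun p => (p.add_le x y).trans
    (add_le_add (le_ciSup (CStarSeminorm.bddAbove x) p) (le_ciSup (CStarSeminorm.bddAbove y) p))
  smul_eq c x := by
    simp_rw [CStarSeminorm.smul_eq]
    exact (Real.mul_iSup_of_nonneg (norm_nonneg c) _).symm
  mul_le x y := ciSup_le fun p => (p.mul_le x y).trans
    (mul_le_mul (le_ciSup (CStarSeminorm.bddAbove x) p) (le_ciSup (CStarSeminorm.bddAbove y) p)
      (p.nonneg _) (Real.iSup_nonneg fun q : CStarSeminorm (A ⊗[ℂ] B) => q.nonneg x))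
  star_mul_self x := by
    have h0 : 0 ≤ ⨆ p : CStarSeminorm (A ⊗[ℂ] B), p.toFun x :=
      Real.iSup_nonneg fun q : CStarSeminorm (A ⊗[ℂ] B) => q.nonneg x
    refine le_antisymm (ciSup_le fun p => ?_) ?_
    · rw [p.star_mul_self]
      have := le_ciSup (CStarSeminorm.bddAbove x) p
      exact mul_le_mul this this (p.nonneg _) h0
    · have h1 : (⨆ p : CStarSeminorm (A ⊗[ℂ] B), p.toFun x) ≤
          √(⨆ p : CStarSeminorm (A ⊗[ℂ] B), p.toFun (star x * x)) := by
        refine ciSup_le fun p => Real.le_sqrt_of_sq_le ?_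
        rw [sq, ← p.star_mul_self]
        exact le_ciSup (CStarSeminorm.bddAbove (star x * x)) p
      rw [← sq]
      exact (Real.le_sqrt h0 (Real.iSup_nonneg fun q : CStarSeminorm (A ⊗[ℂ] B) => q.nonneg _)).1 h1

theorem le_maxCStarNorm (p : CStarSeminorm (A ⊗[ℂ] B)) (x : A ⊗[ℂ] B) :
    p.toFun x ≤ (maxCStarNorm A B).toFun x :=
  le_ciSup (CStarSeminorm.bddAbove x) p

/-- The maximal tensor product of two unital C*-algebras. -/
def MaxTensor : Type _ := (maxCStarNorm A B).Compl

namespace MaxTensor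

instance : CStarAlgebra (MaxTensor A B) := inferInstanceAs (CStarAlgebra (maxCStarNorm A B).Compl)

variable {A B}

/-- The canonical `*`-homomorphism from the algebraic tensor product. -/
def ofAlg : A ⊗[ℂ] B →⋆ₐ[ℂ] MaxTensor A B := CStarSeminorm.Compl.ofHom (maxCStarNorm A B)

theorem denseRange_ofAlg : DenseRange (ofAlg : A ⊗[ℂ] B → MaxTensor A B) :=
  CStarSeminorm.Compl.denseRange_of (maxCStarNorm A B)

/-- The elementary tensor `a ⊗ b`. -/
def tmul (a : A) (b : B) : MaxTensor A B := ofAlg (a ⊗ₜ b)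

/-- The universal property: a `*`-homomorphism on the algebraic tensor product extends. -/
def lift {C : Type*} [CStarAlgebra C] (f : A ⊗[ℂ] B →⋆ₐ[ℂ] C) : MaxTensor A B →⋆ₐ[ℂ] C :=
  CStarSeminorm.Compl.lift (maxCStarNorm A B) f
    fun x => le_maxCStarNorm A B (CStarSeminorm.comap f) x

theorem lift_ofAlg {C : Type*} [CStarAlgebra C] (f : A ⊗[ℂ] B →⋆ₐ[ℂ] C) (x : A ⊗[ℂ] B) :
    lift f (ofAlg x) = f x :=
  CStarSeminorm.Compl.lift_of _ f _ x

theorem hom_ext {C : Type*} [CStarAlgebra C] {f g : MaxTensor A B →⋆ₐ[ℂ] C}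
    (h : ∀ a b, f (tmul a b) = g (tmul a b)) : f = g := by
  refine DFunLike.ext _ _ fun x => ?_
  have hc (k : MaxTensor A B →⋆ₐ[ℂ] C) : Continuous k :=
    AddMonoidHomClass.continuous_of_bound k 1
      fun x => by simpa using NonUnitalStarAlgHom.norm_apply_le k x
  refine denseRange_ofAlg.induction_on x (isClosed_eq (hc f) (hc g)) fun y => ?_
  induction y with
  | zero => simp
  | tmul a b => exact h a b
  | add x y hx hy => rw [map_add, map_add, map_add, hx, hy]

variable {A' B' : Type*} [CStarAlgebra A'] [CStarAlgebra B']

/-- The tensor product `f ⊗ g` of two `*`-homomorphisms. -/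
def map (f : A →⋆ₐ[ℂ] A') (g : B →⋆ₐ[ℂ] B') : MaxTensor A B →⋆ₐ[ℂ] MaxTensor A' B' :=
  lift (ofAlg.comp
    { Algebra.TensorProduct.map f.toAlgHom g.toAlgHom with
      map_star' := fun x => by
        induction x with
        | zero => simp
        | tmul a b => simp [TensorProduct.star_tmul, map_star]
        | add x y hx hy => simp_all [star_add] })

theorem map_tmul (f : A →⋆ₐ[ℂ] A') (g : B →⋆ₐ[ℂ] B') (a : A) (b : B) :
    map f g (tmul a b) = tmul (f a) (g b) :=
  lift_ofAlg _ _

/-- The tensor product `f ⊗ g` of two `*`-isomorphisms. -/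
def congr (f : A ≃⋆ₐ[ℂ] A') (g : B ≃⋆ₐ[ℂ] B') : MaxTensor A B ≃⋆ₐ[ℂ] MaxTensor A' B' :=
  StarAlgEquiv.ofStarAlgHom (map (f : A →⋆ₐ[ℂ] A') (g : B →⋆ₐ[ℂ] B'))
    (map (f.symm : A' →⋆ₐ[ℂ] A) (g.symm : B' →⋆ₐ[ℂ] B))
    (hom_ext fun a b => by simp [map_tmul])
    (hom_ext fun a b => by simp [map_tmul])

theorem congr_tmul (f : A ≃⋆ₐ[ℂ] A') (g : B ≃⋆ₐ[ℂ] B') (a : A) (b : B) :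
    congr f g (tmul a b) = tmul (f a) (g b) :=
  map_tmul _ _ _ _

end MaxTensor

end MaxTensor

/-! ### Infinite tensor products of matrix algebras -/

/-- The C*-algebra `𝕄_d` of complex `d × d` matrices. -/
abbrev Mat (d : ℕ) : Type := CStarMatrix (Fin d) (Fin d) ℂ

section Spin

variable (I : Type) (d : ℕ) [NeZero d]

/-- The Hilbert space of an `I`-indexed family of `d`-level systems relative to the reference
vector `|0⟩` at every site: it has an orthonormal basis consisting of the configurations
`I → {0, …, d - 1}` that vanish at all but finitely many sites. -/
abbrev ConfigSpace : Type := lp (fun _ : I →₀ Fin d => ℂ) 2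

variable {I d}

theorem summable_update (i : I) (k : Fin d) (ξ : ConfigSpace I d) :
    Summable fun c : I →₀ Fin d => ‖ξ (c.update i k)‖ ^ (2 : ℝ) := by
  have hξ : Summable fun c : I →₀ Fin d => ‖ξ c‖ ^ (2 : ℝ) := by
    simpa using (lp.memℓp ξ).summable (by norm_num)
  have h1 : ∀ j : Fin d, Summable
      ({c : I →₀ Fin d | c i = j}.indicator fun c => ‖ξ (c.update i k)‖ ^ (2 : ℝ)) := by
    intro j
    rw [← summable_subtype_iff_indicator]
    refine hξ.comp_injective (i := fun c : {c : I →₀ Fin d | c i = j} => c.1.update i k) ?_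
    rintro ⟨c, hc⟩ ⟨c', hc'⟩ h
    have hc : c i = j := hc
    have hc' : c' i = j := hc'
    refine Subtype.ext (Finsupp.ext fun x => ?_)
    by_cases hx : x = i
    · subst hx; exact hc.trans hc'.symm
    · have := DFunLike.congr_fun h x
      simpa [Finsupp.update, Function.update, hx] using this
  refine (summable_sum fun j (_ : j ∈ Finset.univ) => h1 j).congr fun c => ?_
  simp [Set.indicator_apply]

theorem memℓp_site (i : I) (m : Mat d) (ξ : ConfigSpace I d) :
    Memℓp (fun c : I →₀ Fin d => ∑ k, m (c i) k * ξ (c.update i k)) 2 := by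
  have h1 : ∀ k : Fin d, Memℓp (fun c : I →₀ Fin d => m (c i) k * ξ (c.update i k)) 2 := by
    intro k
    refine memℓp_gen ?_
    simp only [ENNReal.toReal_ofNat]
    refine Summable.of_nonneg_of_le (fun c => by positivity) (fun c => ?_)
      ((summable_update i k ξ).mul_left ((∑ j, ‖m j k‖) ^ (2 : ℝ)))
    rw [norm_mul, Real.mul_rpow (norm_nonneg _) (norm_nonneg _)]
    gcongr
    exact Finset.single_le_sum (f := fun j => ‖m j k‖) (fun j _ => norm_nonneg _)
      (Finset.mem_univ (c i))
  exact Memℓp.finsetSum Finset.univ fun k _ => h1 k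

/-- The matrix `m` acting at the site `i`, and as the identity at all the other sites. -/
def siteLinearMap (i : I) (m : Mat d) : ConfigSpace I d →ₗ[ℂ] ConfigSpace I d where
  toFun ξ := ⟨fun c => ∑ k, m (c i) k * ξ (c.update i k), memℓp_site i m ξ⟩
  map_add' ξ η := by
    ext c
    simp only [lp.coeFn_add, Pi.add_apply, mul_add, Finset.sum_add_distrib]
  map_smul' a ξ := by
    ext c
    simp [Finset.mul_sum, mul_left_comm]

theorem continuous_siteLinearMap (i : I) (m : Mat d) : Continuous (siteLinearMap i m) := by
  refine LinearMap.continuous_of_seq_closed_graph _ fun u x y hu hv => ?_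
  have hev : ∀ c : I →₀ Fin d, Continuous fun ξ : ConfigSpace I d => ξ c := fun c =>
    (lp.evalCLM ℂ (fun _ : I →₀ Fin d => ℂ) c (p := 2)).continuous
  ext c
  refine tendsto_nhds_unique (((hev c).tendsto y).comp hv) ?_
  have h2 : Continuous fun ξ : ConfigSpace I d => siteLinearMap i m ξ c :=
    continuous_finsetSum Finset.univ fun k _ =>
      (hev (c.update i k)).const_mul (m (c i) k)
  exact (h2.tendsto x).comp hu

/-- The bounded operator given by the matrix `m` at the site `i`, and the identity elsewhere. -/
def siteOp (i : I) (m : Mat d) : ConfigSpace I d →L[ℂ] ConfigSpace I d :=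
  ⟨siteLinearMap i m, continuous_siteLinearMap i m⟩

theorem siteOp_apply (i : I) (m : Mat d) (ξ : ConfigSpace I d) (c : I →₀ Fin d) :
    siteOp i m ξ c = ∑ k, m (c i) k * ξ (c.update i k) := rfl

variable (I d)

/-- The norm closed `*`-algebra of operators generated by the matrices at single sites. -/
def spinSubalgebra : StarSubalgebra ℂ (ConfigSpace I d →L[ℂ] ConfigSpace I d) :=
  (StarAlgebra.adjoin ℂ (Set.range fun x : I × Mat d => siteOp x.1 x.2)).topologicalClosure

/-- The infinite tensor product `⨂_{i ∈ I} 𝕄_d`, that is, the C*-inductive limit of the matrix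
algebras `⨂_{i ∈ F} 𝕄_d`, `F ⊆ I` finite, under the unital embeddings `a ↦ a ⊗ 1`. It is realised
as the norm closure of the operators that act as the identity outside a finite set of sites. -/
def SpinAlg : Type := spinSubalgebra I d

instance SpinAlg.instCStarAlgebra : CStarAlgebra (SpinAlg I d) :=
  StarSubalgebra.cstarAlgebra (spinSubalgebra I d)
    (h_closed := StarSubalgebra.isClosed_topologicalClosure _)

variable {I d}

/-- The embedding of `𝕄_d` into `⨂_{i ∈ I} 𝕄_d` as the tensor factor at the site `i`. -/
def SpinAlg.site (i : I) (m : Mat d) : SpinAlg I d :=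
  ⟨siteOp i m, StarSubalgebra.le_topologicalClosure _
    (StarAlgebra.subset_adjoin ℂ _ ⟨(i, m), rfl⟩)⟩

end Spin

/-- The CAR algebra `⨂_{k ∈ ℕ} 𝕄_2`. -/
abbrev CAR : Type := SpinAlg ℕ 2

/-! ### States and embezzlement -/

/-- A state on a unital C*-algebra: a positive linear functional with value `1` at `1`. -/
structure AbstractState (A : Type*) [CStarAlgebra A] where
  /-- the underlying linear functional -/
  toLinearMap : A →ₗ[ℂ] ℂ
  nonneg : ∀ a, 0 ≤ toLinearMap (star a * a)
  map_one : toLinearMap 1 = 1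

instance (A : Type*) [CStarAlgebra A] : CoeFun (AbstractState A) fun _ => A → ℂ :=
  ⟨fun s => s.toLinearMap⟩

/-- The Hilbert space `ℂ^d ⊗ ℂ^d`, with its orthonormal basis `|j k⟩`. -/
abbrev Bipartite (d : ℕ) : Type := EuclideanSpace ℂ (Fin d × Fin d)

section Embezzlement

variable {d : ℕ}

/-- The number `⟨φ| m ⊗ m' |φ⟩`. -/
def expect (φ : Bipartite d) (m m' : Mat d) : ℂ :=
  ∑ x, ∑ y, star (φ x) * (m x.1 y.1 * m' x.2 y.2) * φ y

/-- The vector `|0 0⟩`. -/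
def ket00 (d : ℕ) [NeZero d] : Bipartite d := EuclideanSpace.single (0, 0) 1

/-- The vector `(U ⊗ V)|φ⟩`. -/
def localUnitary (U V : unitary (Mat d)) (φ : Bipartite d) : Bipartite d :=
  WithLp.toLp 2 fun x => ∑ y, (U : Mat d) x.1 y.1 * (V : Mat d) x.2 y.2 * φ y

variable {A B : Type*} [CStarAlgebra A] [CStarAlgebra B]

/-- `ω` is the state `s ⊗ s_φ`, where `s_φ(m ⊗ m') = ⟨φ| m ⊗ m' |φ⟩`, after the canonical
reordering of the tensor factors `A ⊗ B ⊗ 𝕄_d ⊗ 𝕄_d` into `(A ⊗ 𝕄_d) ⊗ (B ⊗ 𝕄_d)`. As states are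
continuous and elementary tensors span a dense subspace, there is at most one such `ω`. -/
def IsJointState (s : AbstractState (MaxTensor A B)) (φ : Bipartite d)
    (ω : AbstractState (MaxTensor (MaxTensor A (Mat d)) (MaxTensor B (Mat d)))) : Prop :=
  ∀ (a : A) (b : B) (m m' : Mat d),
    ω (.tmul (.tmul a m) (.tmul b m')) = s (.tmul a b) * expect φ m m'

/-- Exact embezzlement of `φ` from the catalyst state `s` by means of the local `*`-automorphisms
`α` (of Alice) and `β` (of Bob): `(s ⊗ s_0 ⊗ s_0) ((α ⊗ β) X) = (s ⊗ s_φ) X` for all `X`. -/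
def Embezzles [NeZero d] (s : AbstractState (MaxTensor A B))
    (α : MaxTensor A (Mat d) ≃⋆ₐ[ℂ] MaxTensor A (Mat d))
    (β : MaxTensor B (Mat d) ≃⋆ₐ[ℂ] MaxTensor B (Mat d)) (φ : Bipartite d) : Prop :=
  ∃ ω₀ ω : AbstractState (MaxTensor (MaxTensor A (Mat d)) (MaxTensor B (Mat d))),
    IsJointState s (ket00 d) ω₀ ∧ IsJointState s φ ω ∧
      ∀ X, ω₀ (MaxTensor.congr α β X) = ω X

/-- The automorphism of `A ⊗ 𝕄_d` that conjugates the external factor: `m ↦ U⁻¹ m U`. -/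
def externalUnitary (A : Type*) [CStarAlgebra A] (U : unitary (Mat d)) :
    MaxTensor A (Mat d) ≃⋆ₐ[ℂ] MaxTensor A (Mat d) :=
  MaxTensor.congr (StarAlgEquiv.refl ℂ A) (Unitary.conjStarAlgAut ℂ (Mat d) U⁻¹)

end Embezzlement

/-! ### The protocol -/

/-- The vectors `(q_1, …, q_{2^n})` of positive Schmidt coefficients whose squares are rational and
sum up to `1`. -/
def schmidtVectors (n : ℕ) : Set (EuclideanSpace ℝ (Fin (2 ^ n))) :=
  {q | (∀ i, 0 < q i) ∧ (∀ i, ∃ r : ℚ, (q i) ^ 2 = r) ∧ ∑ i, (q i) ^ 2 = 1}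

/-- The `2n`-qubit state `|φ_q⟩ = ∑ i, q_i |i i⟩`. -/
def schmidtState {n : ℕ} (q : EuclideanSpace ℝ (Fin (2 ^ n))) : Bipartite (2 ^ n) :=
  WithLp.toLp 2 fun x => if x.1 = x.2 then ((q x.1 : ℝ) : ℂ) else 0

/-- The states `(U ⊗ V)|φ_q⟩`, with `U` and `V` local unitaries. -/
def targetStates (n : ℕ) : Set (Bipartite (2 ^ n)) :=
  {φ | ∃ q ∈ schmidtVectors n, ∃ U V : unitary (Mat (2 ^ n)),
    φ = localUnitary U V (schmidtState q)}

/-- The sites of the catalyst: for each `q`, a two-way infinite chain. -/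
abbrev Site (n : ℕ) : Type := schmidtVectors n × ℤ

/-- The algebra of Alice (and of Bob): the infinite tensor product, over all `q`, of the infinite
tensor product over `ℤ` of `𝕄_{2^n}`. -/
abbrev Register (n : ℕ) : Type := SpinAlg (Site n) (2 ^ n)

section Protocol

variable {n : ℕ}

/-- The vector in `ℂ^{2^n} ⊗ ℂ^{2^n}` that Alice and Bob share at the site `(q, j)`: it is `|0 0⟩`
for `j ≤ 0`, and `|φ_q⟩` for `j ≥ 1`. -/
def siteState (x : Site n) : Bipartite (2 ^ n) :=
  if x.2 ≤ 0 then ket00 (2 ^ n) else schmidtState x.1.1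

/-- The catalyst: the infinite tensor product state of the states given by `siteState`. -/
def IsCatalyst (s : AbstractState (MaxTensor (Register n) (Register n))) : Prop :=
  ∀ (l : List (Site n)) (_ : l.Nodup) (M N : Site n → Mat (2 ^ n)),
    s (.tmul (l.map fun x => SpinAlg.site x (M x)).prod (l.map fun x => SpinAlg.site x (N x)).prod)
      = (l.map fun x => expect (siteState x) (M x) (N x)).prod

/-- The shift of the chain `q` by one site, with identity action on the other chains. -/
def IsShift (q : schmidtVectors n) (σ : Register n ≃⋆ₐ[ℂ] Register n) : Prop :=
  (∀ (j : ℤ) (m : Mat (2 ^ n)), σ (.site (q, j) m) = .site (q, j + 1) m) ∧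
    ∀ (p : schmidtVectors n), p ≠ q → ∀ (j : ℤ) (m : Mat (2 ^ n)),
      σ (.site (p, j) m) = .site (p, j) m

/-- The swap of the site `(q, 0)` with the external `n` qubits, with identity action on the other
sites. -/
def IsSwap (q : schmidtVectors n)
    (τ : MaxTensor (Register n) (Mat (2 ^ n)) ≃⋆ₐ[ℂ] MaxTensor (Register n) (Mat (2 ^ n))) :
    Prop :=
  (∀ m : Mat (2 ^ n), τ (.tmul (.site (q, 0) m) 1) = .tmul 1 m) ∧
    (∀ m : Mat (2 ^ n), τ (.tmul 1 m) = .tmul (.site (q, 0) m) 1) ∧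
      ∀ x : Site n, x ≠ (q, 0) → ∀ m : Mat (2 ^ n),
        τ (.tmul (.site x m) 1) = .tmul (.site x m) 1

/-- The swap followed by the shift. -/
def shiftAfterSwap (σ : Register n ≃⋆ₐ[ℂ] Register n)
    (τ : MaxTensor (Register n) (Mat (2 ^ n)) ≃⋆ₐ[ℂ] MaxTensor (Register n) (Mat (2 ^ n))) :
    MaxTensor (Register n) (Mat (2 ^ n)) ≃⋆ₐ[ℂ] MaxTensor (Register n) (Mat (2 ^ n)) :=
  τ.trans (MaxTensor.congr σ (StarAlgEquiv.refl ℂ (Mat (2 ^ n))))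

end Protocol

end

/-! Embezzlement here is a Hilbert hotel. The external pair counts as one further site next to the
sites `(q, j)`. Swap followed by shift then acts as a permutation of sites: the external site goes
to `(q, 1)`, `(q, 0)` goes to the external site, `(q, j)` goes to `(q, j + 1)` for `j ≠ 0`, and the
other chains stay fixed. The initial state, with |00⟩ at the external site, is a product over sites,
and pulling a product state back along a permutation of sites permutes its factors. The external
factor becomes the one at `(q, 1)`, which is |φ_q⟩; the factor at `(q, 0)` becomes the external
|00⟩, which is what it was; every other factor is moved only to a site with an equal factor. So the
result is the catalyst times |φ_q⟩. Conjugating the external factor beforehand turns |φ_q⟩ into (U ⊗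
V)|φ_q⟩.

The operator-algebraic content is the universal property `SpinAlg.lift` of the infinite tensor
product: commuting unital copies of `Mat d` in a C*-algebra extend to a homomorphism on the whole.
Finitely many copies lie in the image of one matrix algebra (`CommutingFamily.exists_matrixHom`),
which is simple, so its unital `*`-homomorphisms to nontrivial algebras are isometric. This isometry
survives passage to the closure of the graph. It also gives injectivity, so a nontrivial C*-algebra
generated by commuting copies of `Mat d` is their tensor product (`SpinAlg.equivOfGenerates`). The
identification with the CAR algebra and the treatment of the external factor as a site both come
from this.

Product states exist because both parties can be placed in one copy of `Mat (d * d)` per site, where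
a unitary rotates the vacuum vector to the prescribed one (`SpinAlg.exists_productState`).
Continuous functionals are determined by products of single-site matrices
(`SpinAlg.functional_ext`), so the identities between states reduce to finite products. Density
follows from the Schmidt decomposition and rational approximation of the squared coefficients. -/

noncomputable section

/-! ### Matrix units -/

section MatrixUnits

variable {J : Type*} [Fintype J] [DecidableEq J]

/-- The matrix unit with entry `1` at `(j, k)`. -/
def matUnit (j k : J) : CStarMatrix J J ℂ := CStarMatrix.ofMatrix (Matrix.single j k 1)

theorem matUnit_apply (j k a b : J) :
    (matUnit j k : CStarMatrix J J ℂ) a b = if j = a ∧ k = b then 1 else 0 := rfl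

theorem matUnit_mul (a b c e : J) :
    (matUnit a b * matUnit c e : CStarMatrix J J ℂ) = if b = c then matUnit a e else 0 := by
  split_ifs with h
  · subst h
    exact (Matrix.single_mul_single_same (c := (1 : ℂ)) a b e 1).trans (by rw [one_mul]; rfl)
  · exact Matrix.single_mul_single_of_ne (1 : ℂ) a b c h (1 : ℂ)

theorem star_matUnit (a b : J) : star (matUnit a b : CStarMatrix J J ℂ) = matUnit b a := by
  ext i j
  rw [CStarMatrix.star_apply, matUnit_apply, matUnit_apply]
  by_cases h : a = j ∧ b = i
  · rw [if_pos h, if_pos h.symm, star_one]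
  · rw [if_neg h, if_neg (fun h' => h h'.symm), star_zero]

theorem sum_matUnit : ∑ a, (matUnit a a : CStarMatrix J J ℂ) = 1 :=
  Matrix.sum_single_one

theorem eq_sum_matUnit (z : CStarMatrix J J ℂ) : z = ∑ a, ∑ b, z a b • matUnit a b := by
  refine (Matrix.matrix_eq_sum_single z).trans ?_
  refine Finset.sum_congr rfl fun a _ => Finset.sum_congr rfl fun b _ => ?_
  exact (by simp : Matrix.single a b (z a b) = z a b • Matrix.single a b (1 : ℂ))

variable {C : Type*} [CStarAlgebra C]

/-- The `*`-homomorphism from a matrix algebra given by a system of matrix units. -/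
def matUnitHom (e : J → J → C) (hmul : ∀ a b c k, e a b * e c k = if b = c then e a k else 0)
    (hone : ∑ a, e a a = 1) (hstar : ∀ a b, star (e a b) = e b a) :
    CStarMatrix J J ℂ →⋆ₐ[ℂ] C where
  toFun z := ∑ a, ∑ b, z a b • e a b
  map_one' := by
    rw [← hone]
    refine Finset.sum_congr rfl fun a _ => ?_
    simp [CStarMatrix.one_apply, ite_smul]
  map_mul' z w := by
    have h : (∑ a, ∑ b, z a b • e a b) * (∑ a, ∑ b, w a b • e a b) =
        ∑ x, ∑ a, ∑ y, (z a x * w x y) • e a y := by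
      simp only [Finset.sum_mul, Finset.mul_sum, smul_mul_smul_comm, hmul, smul_ite, smul_zero]
      refine Finset.sum_congr rfl fun x _ => ?_
      rw [Finset.sum_comm]
      simp
    rw [h]
    conv_rhs => rw [Finset.sum_comm]
    refine Finset.sum_congr rfl fun a _ => ?_
    conv_rhs => rw [Finset.sum_comm]
    exact Finset.sum_congr rfl fun y _ => by rw [CStarMatrix.mul_apply, Finset.sum_smul]
  map_zero' := by simp
  map_add' z w := by simp [add_smul, Finset.sum_add_distrib]
  commutes' c := by
    rw [Algebra.algebraMap_eq_smul_one (A := C), ← hone, Finset.smul_sum]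
    refine Finset.sum_congr rfl fun a _ => ?_
    simp [CStarMatrix.algebraMap_apply, ite_smul]
  map_star' z := by
    simp only [star_sum, star_smul, hstar, CStarMatrix.star_apply]
    exact Finset.sum_comm

theorem matUnitHom_apply (e : J → J → C)
    (hmul : ∀ a b c k, e a b * e c k = if b = c then e a k else 0)
    (hone : ∑ a, e a a = 1) (hstar : ∀ a b, star (e a b) = e b a) (z : CStarMatrix J J ℂ) :
    matUnitHom e hmul hone hstar z = ∑ a, ∑ b, z a b • e a b := rfl

theorem matUnitHom_matUnit (e : J → J → C)
    (hmul : ∀ a b c k, e a b * e c k = if b = c then e a k else 0)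
    (hone : ∑ a, e a a = 1) (hstar : ∀ a b, star (e a b) = e b a) (a b : J) :
    matUnitHom e hmul hone hstar (matUnit a b) = e a b := by
  simp [matUnitHom_apply, matUnit_apply, ite_and, ite_smul]

/-- A full matrix algebra over a field is a simple ring. For `*`-homomorphisms of C*-algebras
injectivity yields isometry, and this is how all norm estimates below arise. -/
theorem injective_of_cstarMatrix [Nonempty J] [Nontrivial C] (f : CStarMatrix J J ℂ →⋆ₐ[ℂ] C) :
    Function.Injective f := by
  let g : Matrix J J ℂ →+* C :=
    (f : CStarMatrix J J ℂ →+* C).comp (CStarMatrix.ofMatrixRingEquiv : Matrix J J ℂ ≃+* _)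
  exact g.injective

end MatrixUnits

/-! ### Commuting families of matrix algebras -/

/-- Two `*`-homomorphisms from `Mat d` belonging to different indices have commuting ranges. -/
def CommutingFamily {I : Type*} {d : ℕ} {C : Type*} [CStarAlgebra C]
    (f : I → Mat d →⋆ₐ[ℂ] C) : Prop :=
  ∀ i j, i ≠ j → ∀ m m', Commute (f i m) (f j m')

/-- Products of matrix units from two commuting systems are matrix units indexed by pairs. The last
clause keeps track of the commutant so that the construction can be iterated. -/
theorem exists_matrixHom_insert {d : ℕ} {J : Type} [Fintype J] [DecidableEq J] {C : Type*}
    [CStarAlgebra C] (f : Mat d →⋆ₐ[ℂ] C) (Φ : CStarMatrix J J ℂ →⋆ₐ[ℂ] C)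
    (hc : ∀ m z, Commute (f m) (Φ z)) :
    ∃ Ψ : CStarMatrix (Fin d × J) (Fin d × J) ℂ →⋆ₐ[ℂ] C, (∀ m z, f m * Φ z ∈ Ψ.range) ∧
      ∀ y : C, (∀ m, Commute y (f m)) → (∀ z, Commute y (Φ z)) → ∀ w, Commute y (Ψ w) := by
  let e : Fin d × J → Fin d × J → C := fun a b => f (matUnit a.1 b.1) * Φ (matUnit a.2 b.2)
  let Ψ := matUnitHom e
    (by
      rintro ⟨a, a'⟩ ⟨b, b'⟩ ⟨c, c'⟩ ⟨k, k'⟩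
      have h1 : e (a, a') (b, b') * e (c, c') (k, k') =
          f (matUnit a b * matUnit c k) * Φ (matUnit a' b' * matUnit c' k') := by
        rw [map_mul, map_mul]
        exact (hc _ _).symm.mul_mul_mul_comm _ _
      rw [h1, matUnit_mul, matUnit_mul]
      by_cases hb : b = c <;> by_cases hb' : b' = c' <;> simp [hb, hb', e])
    (by
      rw [Fintype.sum_prod_type]
      simp only [e, ← Finset.mul_sum, ← map_sum, sum_matUnit, map_one, mul_one])
    (by
      intro a b
      simp only [e, star_mul, ← map_star, star_matUnit]
      exact ((hc _ _).eq).symm)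
  refine ⟨Ψ, fun m z => ?_, fun y h1 h2 w => ?_⟩
  · rw [eq_sum_matUnit m, eq_sum_matUnit z]
    simp only [map_sum, map_smul, Finset.sum_mul, Finset.mul_sum, smul_mul_smul_comm]
    refine sum_mem fun a _ => sum_mem fun b _ => sum_mem fun a' _ => sum_mem fun b' _ => ?_
    refine Ψ.range.smul_mem ⟨matUnit (a', a) (b', b), ?_⟩ _
    exact matUnitHom_matUnit e _ _ _ _ _
  · simp only [Ψ, matUnitHom_apply]
    refine Commute.sum_right _ _ _ fun a _ => Commute.sum_right _ _ _ fun b _ => ?_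
    exact (((h1 _).mul_right (h2 _))).smul_right _

/-- Finitely many commuting copies of `Mat d` sit inside the image of a single matrix algebra, by
adjoining one index at a time. The cardinality serves to identify this algebra with `Mat (d ^ n)`;
the commutation clause is what the induction needs. -/
theorem CommutingFamily.exists_matrixHom {I : Type*} {d : ℕ} [NeZero d] {C : Type*}
    [CStarAlgebra C] {f : I → Mat d →⋆ₐ[ℂ] C} (hf : CommutingFamily f) (F : Finset I) :
    ∃ (J : Type) (_ : Fintype J) (_ : DecidableEq J) (_ : Nonempty J)
      (Φ : CStarMatrix J J ℂ →⋆ₐ[ℂ] C), Fintype.card J = d ^ F.card ∧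
        (∀ i ∈ F, ∀ m, f i m ∈ Φ.range) ∧ ∀ j ∉ F, ∀ m z, Commute (f j m) (Φ z) := by
  classical
  induction F using Finset.induction_on with
  | empty =>
    refine ⟨Unit, inferInstance, inferInstance, inferInstance,
      matUnitHom (fun _ _ => 1) (by simp) (by simp) (by simp), by simp, by simp, ?_⟩
    intro j _ m z
    simp only [matUnitHom_apply]
    exact Commute.sum_right _ _ _ fun a _ => Commute.sum_right _ _ _ fun b _ =>
      (Commute.one_right _).smul_right _
  | insert i F hi ih =>
    obtain ⟨J, _, _, _, Φ, hcard, hmem, hcomm⟩ := ih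
    obtain ⟨Ψ, h1, h2⟩ := exists_matrixHom_insert (f i) Φ (hcomm i hi)
    refine ⟨Fin d × J, inferInstance, inferInstance, inferInstance, Ψ, ?_, ?_, ?_⟩
    · rw [Fintype.card_prod, Fintype.card_fin, hcard, Finset.card_insert_of_notMem hi, pow_succ']
    · intro j hj m
      rcases Finset.mem_insert.1 hj with rfl | hj
      · simpa using h1 m 1
      · obtain ⟨z, hz⟩ := hmem j hj m
        have := h1 1 z
        rw [map_one, one_mul] at this
        exact hz ▸ this
    · intro j hj m
      rw [Finset.mem_insert, not_or] at hj
      exact h2 _ (fun m' => hf j i hj.1 m m') (hcomm j hj.2 m)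

/-- The set `S` generates the C*-algebra `C` as a closed `*`-algebra. -/
def TopologicallyGenerates {C : Type*} [CStarAlgebra C] (S : Set C) : Prop :=
  ∀ T : StarSubalgebra ℂ C, IsClosed (T : Set C) → S ⊆ T → T = ⊤

theorem StarAlgHom.continuous_of_cstar {A B : Type*} [CStarAlgebra A] [CStarAlgebra B]
    (k : A →⋆ₐ[ℂ] B) : Continuous k :=
  AddMonoidHomClass.continuous_of_bound k 1
    fun x => by simpa using NonUnitalStarAlgHom.norm_apply_le k x

theorem StarAlgHom.isClosed_range_of_injective {A B : Type*} [CStarAlgebra A] [CStarAlgebra B]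
    (k : A →⋆ₐ[ℂ] B) (hk : Function.Injective k) : IsClosed (k.range : Set B) :=
  (NonUnitalStarAlgHom.isometry k hk).isClosedEmbedding.isClosed_range

theorem TopologicallyGenerates.hom_ext {A B : Type*} [CStarAlgebra A] [CStarAlgebra B] {S : Set A}
    (hS : TopologicallyGenerates S) {f g : A →⋆ₐ[ℂ] B} (h : ∀ x ∈ S, f x = g x) : f = g := by
  have : StarAlgHom.equalizer f g = ⊤ := hS _
    (isClosed_eq f.continuous_of_cstar g.continuous_of_cstar) h
  ext x
  exact (this ▸ StarSubalgebra.mem_top : x ∈ StarAlgHom.equalizer f g)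

/-- Elements commuting with a `*`-closed generating set commute with everything. -/
theorem TopologicallyGenerates.commute {A B : Type*} [CStarAlgebra A] [CStarAlgebra B] {S : Set A}
    (hS : TopologicallyGenerates S) (f : A →⋆ₐ[ℂ] B) {y : B} (h : ∀ x ∈ S, Commute y (f x))
    (h' : ∀ x ∈ S, Commute (star y) (f x)) (a : A) : Commute y (f a) := by
  have hcl : IsClosed ((StarSubalgebra.centralizer ℂ {y} : StarSubalgebra ℂ B) : Set B) := by
    rw [StarSubalgebra.coe_centralizer]
    exact Set.isClosed_centralizer _
  have : (StarSubalgebra.centralizer ℂ {y}).comap f = ⊤ := by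
    refine hS _ (hcl.preimage f.continuous_of_cstar) fun x hx => ?_
    refine (StarSubalgebra.mem_centralizer_iff ℂ).2 ?_
    rintro _ rfl
    exact ⟨(h x hx).eq, (h' x hx).eq⟩
  have ha : a ∈ (StarSubalgebra.centralizer ℂ {y}).comap f := this ▸ StarSubalgebra.mem_top
  exact ((StarSubalgebra.mem_centralizer_iff ℂ).1 ha y rfl).1

/-! ### The algebra of a spin system -/

section SpinBasic

variable {I : Type} {d : ℕ} [NeZero d]

theorem siteOp_mul (i : I) (m m' : Mat d) : siteOp i (m * m') = siteOp i m * siteOp i m' := by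
  classical
  ext ξ c
  rw [mul_apply_eq_comp, siteOp_apply, siteOp_apply]
  simp only [siteOp_apply, Finsupp.update_idem, Finsupp.update_apply, if_true, Finset.mul_sum,
    CStarMatrix.mul_apply, Finset.sum_mul]
  rw [Finset.sum_comm]
  simp only [mul_assoc]

theorem siteOp_add (i : I) (m m' : Mat d) : siteOp i (m + m') = siteOp i m + siteOp i m' := by
  ext ξ c
  rw [add_apply, lp.coeFn_add, Pi.add_apply]
  simp only [siteOp_apply, CStarMatrix.add_apply, add_mul, Finset.sum_add_distrib]

theorem siteOp_smul (i : I) (a : ℂ) (m : Mat d) : siteOp i (a • m) = a • siteOp i m := by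
  ext ξ c
  rw [smul_apply, lp.coeFn_smul, Pi.smul_apply]
  simp only [siteOp_apply, CStarMatrix.smul_apply, smul_eq_mul, mul_assoc, Finset.mul_sum]

theorem siteOp_one (i : I) : siteOp i (1 : Mat d) = 1 := by
  ext ξ c
  simp [siteOp_apply, CStarMatrix.one_apply]

theorem siteOp_commute {i j : I} (h : i ≠ j) (m m' : Mat d) :
    Commute (siteOp i m) (siteOp j m') := by
  classical
  refine ContinuousLinearMap.ext fun ξ => lp.ext (funext fun c => ?_)
  rw [mul_apply_eq_comp, mul_apply_eq_comp, siteOp_apply, siteOp_apply]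
  simp only [siteOp_apply, Finset.mul_sum, Finsupp.update_apply, if_neg h, if_neg h.symm]
  rw [Finset.sum_comm]
  refine Finset.sum_congr rfl fun k _ => Finset.sum_congr rfl fun l _ => ?_
  rw [Finsupp.update_comm _ h]
  ring

open Classical in
/-- The orthonormal basis vector of a configuration. -/
def configVec (b : I →₀ Fin d) : ConfigSpace I d := lp.single 2 b (1 : ℂ)

open Classical in
theorem configVec_apply (b c : I →₀ Fin d) : (configVec b) c = if c = b then (1 : ℂ) else 0 := by
  rw [configVec, lp.single_apply, Pi.single_apply]

theorem inner_configVec (b : I →₀ Fin d) (ξ : ConfigSpace I d) :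
    inner ℂ (configVec b) ξ = ξ b := by
  classical
  rw [configVec, lp.inner_single_left]
  simp

/-- The definition gives the coordinates of the image of a vector; the adjoint computation needs the
image of a basis vector instead, where the columns of `m` appear. -/
theorem siteOp_configVec (i : I) (m : Mat d) (c : I →₀ Fin d) :
    siteOp i m (configVec c) = ∑ j, m j (c i) • configVec (c.update i j) := by
  classical
  refine lp.ext (funext fun b => ?_)
  rw [siteOp_apply, lp.coeFn_sum, Finset.sum_apply]
  simp only [lp.coeFn_smul, Pi.smul_apply, configVec_apply, smul_eq_mul, mul_ite, mul_one, mul_zero]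
  by_cases h : b.update i (c i) = c
  · have h1 : ∀ k, b.update i k = c ↔ k = c i := fun k =>
      ⟨fun hk => by rw [← hk, Finsupp.update_apply, if_pos rfl], fun hk => hk ▸ h⟩
    have h2 : ∀ k, b = c.update i k ↔ k = b i := fun k =>
      ⟨fun hk => by rw [hk, Finsupp.update_apply, if_pos rfl],
        fun hk => by rw [← h, Finsupp.update_idem, hk, Finsupp.update_self]⟩
    simp [h1, h2]
  · rw [Finset.sum_eq_zero, Finset.sum_eq_zero]
    · intro k _
      rw [if_neg]
      rintro rfl
      exact h (by rw [Finsupp.update_idem, Finsupp.update_self])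
    · intro k _
      rw [if_neg]
      rintro rfl
      exact h (by rw [Finsupp.update_apply, if_pos rfl])

theorem siteOp_star (i : I) (m : Mat d) : siteOp i (star m) = star (siteOp i m) := by
  refine ContinuousLinearMap.ext fun ξ => lp.ext (funext fun c => ?_)
  rw [ContinuousLinearMap.star_eq_adjoint, ← inner_configVec c (ContinuousLinearMap.adjoint _ _),
    ContinuousLinearMap.adjoint_inner_right, siteOp_configVec, sum_inner, siteOp_apply]
  refine Finset.sum_congr rfl fun k _ => ?_
  rw [inner_smul_left, inner_configVec, CStarMatrix.star_apply]
  rfl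

/-! ### Universal property of the infinite tensor product -/

namespace SpinAlg

variable (I d) in
/-- The inclusion into the bounded operators. -/
def val : SpinAlg I d →⋆ₐ[ℂ] (ConfigSpace I d →L[ℂ] ConfigSpace I d) :=
  (spinSubalgebra I d).subtype

theorem val_injective : Function.Injective (val I d) := Subtype.val_injective

theorem val_site (i : I) (m : Mat d) : val I d (site i m) = siteOp i m := rfl

instance : Nontrivial (SpinAlg I d) := by
  refine ⟨⟨0, 1, fun h => ?_⟩⟩
  have h1 := congrArg (fun x => val I d x (configVec 0) 0) h
  simp only [map_zero, map_one, zero_apply, one_apply_eq_self,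
    configVec_apply, if_true] at h1
  exact zero_ne_one h1

/-- The embedding of a tensor factor as a `*`-homomorphism. -/
def siteHom (i : I) : Mat d →⋆ₐ[ℂ] SpinAlg I d where
  toFun := site i
  map_one' := val_injective (by rw [val_site, siteOp_one, map_one])
  map_mul' m m' := val_injective (by rw [map_mul, val_site, val_site, val_site, siteOp_mul])
  map_zero' := val_injective (by
    rw [map_zero, val_site]; simpa using siteOp_smul i 0 (0 : Mat d))
  map_add' m m' := val_injective (by rw [map_add, val_site, val_site, val_site, siteOp_add])
  commutes' c := val_injective (by
    rw [val_site, Algebra.algebraMap_eq_smul_one, Algebra.algebraMap_eq_smul_one, map_smul,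
      siteOp_smul, siteOp_one, map_one])
  map_star' m := val_injective (by rw [map_star, val_site, val_site, siteOp_star])

theorem commutingFamily_siteHom : CommutingFamily (siteHom (I := I) (d := d)) :=
  fun _ _ h m m' => val_injective (by
    rw [map_mul, map_mul]
    exact siteOp_commute h m m')

theorem isometry_val : Isometry (val I d) := NonUnitalStarAlgHom.isometry _ val_injective

/-- Since `val` is isometric, it maps a closed subalgebra to a closed one, so minimality of the
topological closure can be applied inside the bounded operators. -/
theorem generates_site :
    TopologicallyGenerates (Set.range fun x : I × Mat d => site x.1 x.2) := by
  intro T hT hS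
  have hcl : IsClosed (T.map (val I d) : Set (ConfigSpace I d →L[ℂ] ConfigSpace I d)) :=
    isometry_val.isClosedEmbedding.isClosedMap (T : Set (SpinAlg I d)) hT
  have hle : spinSubalgebra I d ≤ T.map (val I d) := by
    refine StarSubalgebra.topologicalClosure_minimal (StarAlgebra.adjoin_le ?_) hcl
    rintro _ ⟨x, rfl⟩
    exact ⟨site x.1 x.2, hS ⟨x, rfl⟩, rfl⟩
  refine eq_top_iff.2 fun x _ => ?_
  obtain ⟨y, hy, hyx⟩ := hle x.2
  exact val_injective hyx ▸ hy

theorem hom_ext {C : Type*} [CStarAlgebra C] {f g : SpinAlg I d →⋆ₐ[ℂ] C}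
    (h : ∀ i m, f (site i m) = g (site i m)) : f = g :=
  generates_site.hom_ext (by rintro _ ⟨x, rfl⟩; exact h _ _)

variable {C : Type*} [CStarAlgebra C]

/-- The graph of the homomorphism to be constructed, before taking the closure. -/
def graph (f : I → Mat d →⋆ₐ[ℂ] C) : StarSubalgebra ℂ (SpinAlg I d × C) :=
  StarAlgebra.adjoin ℂ (Set.range fun x : I × Mat d => (site x.1 x.2, f x.1 x.2))

/-- An element of the algebraic graph involves only finitely many sites, and the pairs (site
embedding, `f i`) are again a commuting family, now in the product algebra. -/
theorem exists_matrixHom_of_mem_graph {f : I → Mat d →⋆ₐ[ℂ] C} (hf : CommutingFamily f)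
    {z : SpinAlg I d × C} (hz : z ∈ graph f) :
    ∃ (J : Type) (_ : Fintype J) (_ : DecidableEq J) (_ : Nonempty J)
      (Φ : CStarMatrix J J ℂ →⋆ₐ[ℂ] SpinAlg I d × C), z ∈ Φ.range := by
  classical
  let g : I → Mat d →⋆ₐ[ℂ] SpinAlg I d × C := fun i => (siteHom i).prod (f i)
  have hg : CommutingFamily g := fun i j h m m' =>
    Prod.ext (commutingFamily_siteHom i j h m m') (hf i j h m m')
  suffices ∃ F : Finset I, z ∈ StarAlgebra.adjoin ℂ
      (Set.range fun x : F × Mat d => g x.1 x.2) by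
    obtain ⟨F, hF⟩ := this
    obtain ⟨J, _, _, _, Φ, -, hmem, -⟩ := hg.exists_matrixHom F
    refine ⟨J, inferInstance, inferInstance, inferInstance, Φ, ?_⟩
    refine StarAlgebra.adjoin_le ?_ hF
    rintro _ ⟨x, rfl⟩
    exact hmem x.1 x.1.2 x.2
  have hmono : ∀ F F' : Finset I, F ⊆ F' →
      StarAlgebra.adjoin ℂ (Set.range fun x : F × Mat d => g x.1 x.2) ≤
        StarAlgebra.adjoin ℂ (Set.range fun x : F' × Mat d => g x.1 x.2) := by
    intro F F' h
    refine StarAlgebra.adjoin_le ?_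
    rintro _ ⟨x, rfl⟩
    exact StarAlgebra.subset_adjoin ℂ _ ⟨(⟨x.1, h x.1.2⟩, x.2), rfl⟩
  refine StarAlgebra.adjoin_induction (p := fun z _ => ∃ F : Finset I, z ∈ StarAlgebra.adjoin ℂ
      (Set.range fun x : F × Mat d => g x.1 x.2)) ?_ ?_ ?_ ?_ ?_ hz
  · rintro _ ⟨x, rfl⟩
    exact ⟨{x.1}, StarAlgebra.subset_adjoin ℂ _ ⟨(⟨x.1, Finset.mem_singleton_self _⟩, x.2), rfl⟩⟩
  · exact fun r => ⟨∅, algebraMap_mem _ r⟩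
  · rintro x y - - ⟨F, hF⟩ ⟨F', hF'⟩
    exact ⟨F ∪ F', add_mem (hmono _ _ Finset.subset_union_left hF)
      (hmono _ _ Finset.subset_union_right hF')⟩
  · rintro x y - - ⟨F, hF⟩ ⟨F', hF'⟩
    exact ⟨F ∪ F', mul_mem (hmono _ _ Finset.subset_union_left hF)
      (hmono _ _ Finset.subset_union_right hF')⟩
  · rintro x - ⟨F, hF⟩
    exact ⟨F, star_mem hF⟩

/-- Both `Φ` and its first component are injective by simplicity, hence isometric, so the norms of
`Φ y` and of its first component both equal the norm of `y`. -/
theorem norm_fst_of_mem_graph {f : I → Mat d →⋆ₐ[ℂ] C} (hf : CommutingFamily f)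
    {z : SpinAlg I d × C} (hz : z ∈ graph f) : ‖z.1‖ = ‖z‖ := by
  obtain ⟨J, _, _, _, Φ, y, rfl⟩ := exists_matrixHom_of_mem_graph hf hz
  have h1 := NonUnitalStarAlgHom.norm_map ((StarAlgHom.fst ℂ (SpinAlg I d) C).comp Φ)
    (injective_of_cstarMatrix _) y
  have h2 := NonUnitalStarAlgHom.norm_map Φ (injective_of_cstarMatrix _) y
  exact h1.trans h2.symm

theorem norm_snd_of_mem_graph [Nontrivial C] {f : I → Mat d →⋆ₐ[ℂ] C} (hf : CommutingFamily f)
    {z : SpinAlg I d × C} (hz : z ∈ graph f) : ‖z.2‖ = ‖z‖ := by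
  obtain ⟨J, _, _, _, Φ, y, rfl⟩ := exists_matrixHom_of_mem_graph hf hz
  have h1 := NonUnitalStarAlgHom.norm_map ((StarAlgHom.snd ℂ (SpinAlg I d) C).comp Φ)
    (injective_of_cstarMatrix _) y
  have h2 := NonUnitalStarAlgHom.norm_map Φ (injective_of_cstarMatrix _) y
  exact h1.trans h2.symm

/-- The closure of the graph is the graph of a homomorphism, injective unless `C` is trivial. -/
theorem exists_hom_of_commutingFamily {f : I → Mat d →⋆ₐ[ℂ] C} (hf : CommutingFamily f) :
    ∃ F : SpinAlg I d →⋆ₐ[ℂ] C, (∀ i m, F (site i m) = f i m) ∧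
      (Nontrivial C → Function.Injective F) := by
  let G := (graph f).topologicalClosure
  have hcl : IsClosed (G : Set (SpinAlg I d × C)) := StarSubalgebra.isClosed_topologicalClosure _
  let _ : CStarAlgebra G := StarSubalgebra.cstarAlgebra G (h_closed := hcl)
  have hcoe : (G : Set (SpinAlg I d × C)) = closure (graph f : Set (SpinAlg I d × C)) :=
    StarSubalgebra.topologicalClosure_coe _
  -- The norm identity is a closed condition. It makes the first projection injective on the closed
  -- graph, so the closure is still the graph of a function.
  have hn : ∀ z ∈ G, ‖z.1‖ = ‖z‖ := by
    intro z hz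
    have hz : z ∈ closure (graph f : Set (SpinAlg I d × C)) := hcoe ▸ hz
    refine closure_minimal (t := {z : SpinAlg I d × C | ‖z.1‖ = ‖z‖})
      (fun z hz => norm_fst_of_mem_graph hf hz) ?_ hz
    exact isClosed_eq (by fun_prop) (by fun_prop)
  let p : G →⋆ₐ[ℂ] SpinAlg I d := (StarAlgHom.fst ℂ (SpinAlg I d) C).comp G.subtype
  have hpi : Function.Injective p := by
    refine (injective_iff_map_eq_zero p).2 fun z hz => ?_
    have h1 := hn z z.2
    have h2 : ‖(z : SpinAlg I d × C).1‖ = 0 := norm_eq_zero.2 hz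
    exact Subtype.ext (norm_eq_zero.1 (h1.symm.trans h2))
  -- The range of an injective `*`-homomorphism is closed, and this one contains the generators, so
  -- the function is defined everywhere.
  have hps : p.range = ⊤ := by
    refine generates_site _ (p.isClosed_range_of_injective hpi) ?_
    rintro _ ⟨x, rfl⟩
    exact ⟨⟨_, StarSubalgebra.le_topologicalClosure _
      (StarAlgebra.subset_adjoin ℂ _ ⟨x, rfl⟩)⟩, rfl⟩
  let e : G ≃⋆ₐ[ℂ] SpinAlg I d := StarAlgEquiv.ofBijective p ⟨hpi, fun x =>
    (hps ▸ StarSubalgebra.mem_top : x ∈ p.range)⟩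
  let q : G →⋆ₐ[ℂ] C := (StarAlgHom.snd ℂ (SpinAlg I d) C).comp G.subtype
  -- The function with this graph is the second projection after the inverse of the first.
  refine ⟨q.comp (e.symm : SpinAlg I d →⋆ₐ[ℂ] G), fun i m => ?_, fun _ => ?_⟩
  · have : e.symm (site i m) = ⟨_, StarSubalgebra.le_topologicalClosure _
        (StarAlgebra.subset_adjoin ℂ _ ⟨(i, m), rfl⟩)⟩ :=
      e.symm_apply_eq.2 rfl
    exact congrArg q this
  · have hn' : ∀ z ∈ G, ‖z.2‖ = ‖z‖ := by
      intro z hz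
      have hz : z ∈ closure (graph f : Set (SpinAlg I d × C)) := hcoe ▸ hz
      refine closure_minimal (t := {z : SpinAlg I d × C | ‖z.2‖ = ‖z‖})
        (fun z hz => norm_snd_of_mem_graph hf hz) ?_ hz
      exact isClosed_eq (by fun_prop) (by fun_prop)
    have hq : Function.Injective q := by
      refine (injective_iff_map_eq_zero q).2 fun z hz => ?_
      have h1 := hn' z z.2
      have h2 : ‖(z : SpinAlg I d × C).2‖ = 0 := norm_eq_zero.2 hz
      exact Subtype.ext (norm_eq_zero.1 (h1.symm.trans h2))
    exact hq.comp e.symm.injective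

/-- The universal property of the infinite tensor product. -/
def lift (f : I → Mat d →⋆ₐ[ℂ] C) (hf : CommutingFamily f) : SpinAlg I d →⋆ₐ[ℂ] C :=
  (exists_hom_of_commutingFamily hf).choose

theorem lift_site (f : I → Mat d →⋆ₐ[ℂ] C) (hf : CommutingFamily f) (i : I) (m : Mat d) :
    lift f hf (site i m) = f i m :=
  (exists_hom_of_commutingFamily hf).choose_spec.1 i m

theorem lift_injective [Nontrivial C] (f : I → Mat d →⋆ₐ[ℂ] C) (hf : CommutingFamily f) :
    Function.Injective (lift f hf) :=
  (exists_hom_of_commutingFamily hf).choose_spec.2 inferInstance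

/-- A nontrivial C*-algebra generated by a commuting family of matrix algebras is their tensor
product. -/
def equivOfGenerates [Nontrivial C] (f : I → Mat d →⋆ₐ[ℂ] C) (hf : CommutingFamily f)
    (hgen : TopologicallyGenerates (Set.range fun x : I × Mat d => f x.1 x.2)) :
    SpinAlg I d ≃⋆ₐ[ℂ] C :=
  StarAlgEquiv.ofBijective (lift f hf) ⟨lift_injective f hf, fun x => by
    have : (lift f hf).range = ⊤ := by
      refine hgen _ (StarAlgHom.isClosed_range_of_injective _ (lift_injective f hf)) ?_
      rintro _ ⟨x, rfl⟩
      exact ⟨site x.1 x.2, lift_site f hf _ _⟩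
    exact (this ▸ StarSubalgebra.mem_top : x ∈ (lift f hf).range)⟩

theorem equivOfGenerates_site [Nontrivial C] (f : I → Mat d →⋆ₐ[ℂ] C) (hf : CommutingFamily f)
    (hgen : TopologicallyGenerates (Set.range fun x : I × Mat d => f x.1 x.2)) (i : I) (m : Mat d) :
    equivOfGenerates f hf hgen (site i m) = f i m :=
  lift_site f hf i m

end SpinAlg

end SpinBasic

/-! ### Maximal tensor products and the CAR algebra -/

namespace MaxTensor

variable {A B C : Type*} [CStarAlgebra A] [CStarAlgebra B] [CStarAlgebra C]

theorem tmul_mul_tmul (a a' : A) (b b' : B) : tmul a b * tmul a' b' = tmul (a * a') (b * b') := by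
  rw [tmul, tmul, ← map_mul, Algebra.TensorProduct.tmul_mul_tmul, tmul]

theorem tmul_one_one : tmul (1 : A) (1 : B) = 1 := map_one ofAlg

/-- The embedding `a ↦ a ⊗ 1`. -/
def inclLeft : A →⋆ₐ[ℂ] MaxTensor A B :=
  ofAlg.comp
    { Algebra.TensorProduct.includeLeft (R := ℂ) (S := ℂ) (A := A) (B := B) with
      map_star' := fun x => by simp [TensorProduct.star_tmul] }

/-- The embedding `b ↦ 1 ⊗ b`. -/
def inclRight : B →⋆ₐ[ℂ] MaxTensor A B :=
  ofAlg.comp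
    { Algebra.TensorProduct.includeRight (R := ℂ) (A := A) (B := B) with
      map_star' := fun x => by simp [TensorProduct.star_tmul] }

theorem inclLeft_apply (a : A) : inclLeft (B := B) a = tmul a 1 := rfl

theorem inclRight_apply (b : B) : inclRight (A := A) b = tmul 1 b := rfl

theorem tmul_eq (a : A) (b : B) : tmul a b = inclLeft a * inclRight b := by
  rw [inclLeft_apply, inclRight_apply, tmul_mul_tmul, mul_one, one_mul]

theorem commute_incl (a : A) (b : B) : Commute (inclLeft (B := B) a) (inclRight b) := by
  rw [commute_iff_eq, inclLeft_apply, inclRight_apply, tmul_mul_tmul, tmul_mul_tmul]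
  simp

/-- The universal property of the maximal tensor product: two homomorphisms with commuting
ranges. -/
def liftCommute (f : A →⋆ₐ[ℂ] C) (g : B →⋆ₐ[ℂ] C) (h : ∀ a b, Commute (f a) (g b)) :
    MaxTensor A B →⋆ₐ[ℂ] C :=
  lift
    { Algebra.TensorProduct.lift f.toAlgHom g.toAlgHom h with
      map_star' := fun x => by
        induction x with
        | zero => simp
        | tmul a b =>
          have := (h (star a) (star b)).eq
          simpa [TensorProduct.star_tmul, map_star] using this
        | add x y hx hy => simp_all [star_add] }

theorem liftCommute_tmul (f : A →⋆ₐ[ℂ] C) (g : B →⋆ₐ[ℂ] C) (h : ∀ a b, Commute (f a) (g b))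
    (a : A) (b : B) : liftCommute f g h (tmul a b) = f a * g b :=
  lift_ofAlg _ _

/-- The preimages of a closed subalgebra under the two embeddings are closed subalgebras, hence
everything; products then give all elementary tensors. -/
theorem generates_tmul {S : Set A} {T : Set B} (hS : TopologicallyGenerates S)
    (hT : TopologicallyGenerates T) :
    TopologicallyGenerates (inclLeft '' S ∪ inclRight '' T : Set (MaxTensor A B)) := by
  intro U hU hST
  have h1 : U.comap inclLeft = ⊤ := hS _ (hU.preimage inclLeft.continuous_of_cstar)
    fun x hx => hST (Or.inl ⟨x, hx, rfl⟩)
  have h2 : U.comap inclRight = ⊤ := hT _ (hU.preimage inclRight.continuous_of_cstar)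
    fun x hx => hST (Or.inr ⟨x, hx, rfl⟩)
  refine eq_top_iff.2 fun x _ => ?_
  refine denseRange_ofAlg.induction_on (p := (· ∈ U)) x hU fun y => ?_
  induction y with
  | zero => rw [map_zero]; exact zero_mem U
  | tmul a b =>
    have ha : a ∈ U.comap inclLeft := h1 ▸ StarSubalgebra.mem_top
    have hb : b ∈ U.comap inclRight := h2 ▸ StarSubalgebra.mem_top
    change tmul a b ∈ U
    rw [tmul_eq]
    exact mul_mem ha hb
  | add x y hx hy => rw [map_add]; exact add_mem hx hy

end MaxTensor

theorem topologicallyGenerates_univ {C : Type*} [CStarAlgebra C] :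
    TopologicallyGenerates (Set.univ : Set C) :=
  fun _ _ h => eq_top_iff.2 fun x _ => h (Set.mem_univ x)

theorem TopologicallyGenerates.mono {C : Type*} [CStarAlgebra C] {S T : Set C}
    (hS : TopologicallyGenerates S) (h : S ⊆ T) : TopologicallyGenerates T :=
  fun U hU hT => hS U hU (h.trans hT)

/-! ### Tensor products and regroupings of spin systems -/

namespace SpinAlg

variable {I K : Type} {d : ℕ} [NeZero d] {C : Type*} [CStarAlgebra C]

theorem commute_lift (f : I → Mat d →⋆ₐ[ℂ] C) (hf : CommutingFamily f) {y : C}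
    (h : ∀ i m, Commute y (f i m)) (h' : ∀ i m, Commute (star y) (f i m)) (a : SpinAlg I d) :
    Commute y (lift f hf a) := by
  refine generates_site.commute (lift f hf) ?_ ?_ a
  · rintro _ ⟨x, rfl⟩
    exact lift_site f hf x.1 x.2 ▸ h _ _
  · rintro _ ⟨x, rfl⟩
    exact lift_site f hf x.1 x.2 ▸ h' _ _

theorem commutingFamily_comp_injective {f : I → Mat d →⋆ₐ[ℂ] C} (hf : CommutingFamily f) {g : K → I}
    (hg : Function.Injective g) : CommutingFamily fun k => f (g k) :=
  fun _ _ h => hf _ _ (hg.ne h)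

/-- The homomorphism that relabels the sites. -/
def relabel (g : K → I) (hg : Function.Injective g) : SpinAlg K d →⋆ₐ[ℂ] SpinAlg I d :=
  lift (fun k => siteHom (g k)) (commutingFamily_comp_injective commutingFamily_siteHom hg)

theorem relabel_site (g : K → I) (hg : Function.Injective g) (k : K) (m : Mat d) :
    relabel g hg (site k m) = site (g k) m := lift_site _ _ _ _

theorem commute_relabel (g : K → I) (hg : Function.Injective g) {i : I} (hi : ∀ k, i ≠ g k)
    (m : Mat d) (a : SpinAlg K d) : Commute (site i m) (relabel g hg a) := by
  refine commute_lift _ _ (fun k m' => commutingFamily_siteHom _ _ (hi k) _ _) (fun k m' => ?_) a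
  have h : star (site i m) = siteHom i (star m) := (map_star (siteHom i) m).symm
  exact h ▸ commutingFamily_siteHom _ _ (hi k) _ _

theorem commute_relabel_relabel {L : Type} (g : K → I) (hg : Function.Injective g) (g' : L → I)
    (hg' : Function.Injective g') (h : ∀ k l, g k ≠ g' l) (a : SpinAlg K d) (b : SpinAlg L d) :
    Commute (relabel g hg a) (relabel g' hg' b) := by
  refine (commute_lift _ _ (fun k m' => ?_) (fun k m' => ?_) a).symm
  · exact (commute_relabel g' hg' (h k) m' b).symm
  · rw [← map_star]
    exact (commute_relabel g' hg' (h k) m' _).symm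

/-- A maximal tensor product is defined by a supremum of seminorms, so `1 ≠ 0` needs a
representation: put both factors on disjoint sets of sites of one spin system. -/
instance nontrivial_maxTensor : Nontrivial (MaxTensor (SpinAlg I d) (SpinAlg K d)) :=
  RingHom.domain_nontrivial (MaxTensor.liftCommute
    (relabel (I := I ⊕ K) (d := d) Sum.inl Sum.inl_injective)
    (relabel (I := I ⊕ K) (d := d) Sum.inr Sum.inr_injective)
    (commute_relabel_relabel _ _ _ _ (by simp)) : _ →+* SpinAlg (I ⊕ K) d)

instance nontrivial_maxTensor_mat : Nontrivial (MaxTensor (SpinAlg I d) (Mat d)) :=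
  RingHom.domain_nontrivial (MaxTensor.liftCommute
    (relabel (I := Option I) (d := d) some (Option.some_injective _))
    (siteHom none)
    (fun a m => (commute_relabel _ _ (by simp) m a).symm) : _ →+* SpinAlg (Option I) d)

variable (I K d) in
/-- The family that exhibits `SpinAlg I d ⊗ SpinAlg K d` as an infinite tensor product. -/
def sumFamily : I ⊕ K → Mat d →⋆ₐ[ℂ] MaxTensor (SpinAlg I d) (SpinAlg K d) :=
  Sum.elim (fun i => MaxTensor.inclLeft.comp (siteHom i))
    (fun k => MaxTensor.inclRight.comp (siteHom k))

theorem commutingFamily_sumFamily : CommutingFamily (sumFamily I K d) := by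
  rintro (i | i) (j | j) h m m'
  · exact (commutingFamily_siteHom i j (by simpa using h) m m').map MaxTensor.inclLeft
  · exact MaxTensor.commute_incl _ _
  · exact (MaxTensor.commute_incl _ _).symm
  · exact (commutingFamily_siteHom i j (by simpa using h) m m').map MaxTensor.inclRight

theorem generates_sumFamily :
    TopologicallyGenerates (Set.range fun x : (I ⊕ K) × Mat d => sumFamily I K d x.1 x.2) := by
  refine (MaxTensor.generates_tmul generates_site generates_site).mono ?_
  rintro _ (⟨_, ⟨x, rfl⟩, rfl⟩ | ⟨_, ⟨x, rfl⟩, rfl⟩)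
  · exact ⟨(Sum.inl x.1, x.2), rfl⟩
  · exact ⟨(Sum.inr x.1, x.2), rfl⟩

variable (I K d) in
/-- The tensor product of two infinite tensor products. -/
def sumEquiv : SpinAlg (I ⊕ K) d ≃⋆ₐ[ℂ] MaxTensor (SpinAlg I d) (SpinAlg K d) :=
  equivOfGenerates (sumFamily I K d) commutingFamily_sumFamily generates_sumFamily

variable (I d) in
/-- The family that exhibits `SpinAlg I d ⊗ Mat d` as an infinite tensor product. -/
def optionFamily : Option I → Mat d →⋆ₐ[ℂ] MaxTensor (SpinAlg I d) (Mat d)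
  | none => MaxTensor.inclRight
  | some i => MaxTensor.inclLeft.comp (siteHom i)

theorem commutingFamily_optionFamily : CommutingFamily (optionFamily I d) := by
  rintro (_ | i) (_ | j) h m m'
  · exact absurd rfl h
  · exact (MaxTensor.commute_incl _ _).symm
  · exact MaxTensor.commute_incl _ _
  · exact (commutingFamily_siteHom i j (by simpa using h) m m').map MaxTensor.inclLeft

theorem generates_optionFamily :
    TopologicallyGenerates (Set.range fun x : Option I × Mat d => optionFamily I d x.1 x.2) := by
  refine (MaxTensor.generates_tmul generates_site topologicallyGenerates_univ).mono ?_
  rintro _ (⟨_, ⟨x, rfl⟩, rfl⟩ | ⟨m, -, rfl⟩)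
  · exact ⟨(some x.1, x.2), rfl⟩
  · exact ⟨(none, m), rfl⟩

variable (I d) in
/-- The tensor product of an infinite tensor product with one further factor. -/
def optionEquiv : SpinAlg (Option I) d ≃⋆ₐ[ℂ] MaxTensor (SpinAlg I d) (Mat d) :=
  equivOfGenerates (optionFamily I d) commutingFamily_optionFamily generates_optionFamily

theorem optionEquiv_none (m : Mat d) : optionEquiv I d (site none m) = .tmul 1 m :=
  equivOfGenerates_site _ _ _ _ _

theorem optionEquiv_some (i : I) (m : Mat d) :
    optionEquiv I d (site (some i) m) = .tmul (site i m) 1 :=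
  equivOfGenerates_site _ _ _ _ _

/-- A finite tensor product of matrix algebras is a matrix algebra. -/
theorem nonempty_matEquiv (n : ℕ) : Nonempty (Mat (d ^ n) ≃⋆ₐ[ℂ] SpinAlg (Fin n) d) := by
  obtain ⟨J, _, _, _, Φ, hcard, hmem, -⟩ :=
    (commutingFamily_siteHom (I := Fin n) (d := d)).exists_matrixHom Finset.univ
  have hinj := injective_of_cstarMatrix Φ
  have hr : Φ.range = ⊤ := by
    refine generates_site _ (Φ.isClosed_range_of_injective hinj) ?_
    rintro _ ⟨x, rfl⟩
    exact hmem x.1 (Finset.mem_univ _) x.2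
  let e : Fin (d ^ n) ≃ J := (Fintype.equivFinOfCardEq (by simpa using hcard)).symm
  exact ⟨(CStarMatrix.reindexₐ ℂ ℂ e).trans (StarAlgEquiv.ofBijective Φ ⟨hinj, fun x =>
    (hr ▸ StarSubalgebra.mem_top : x ∈ Φ.range)⟩)⟩

/-- A countably infinite tensor product of copies of `Mat (2 ^ n)` is the CAR algebra. -/
theorem nonempty_equiv_car [Countable K] [Infinite K] {n : ℕ} (hn : 1 ≤ n) :
    Nonempty (SpinAlg K (2 ^ n) ≃⋆ₐ[ℂ] CAR) := by
  obtain ⟨E⟩ := nonempty_matEquiv (d := 2) n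
  have : Nonempty (Fin n) := ⟨⟨0, hn⟩⟩
  -- Each factor `Mat (2 ^ n)` splits into `n` qubits, so the qubits are indexed by `K × Fin n`,
  -- which is infinite as `n ≥ 1`.
  obtain ⟨e⟩ : Nonempty (ℕ ≃ K × Fin n) := nonempty_equiv_of_countable
  let j : K → SpinAlg (Fin n) 2 →⋆ₐ[ℂ] SpinAlg K (2 ^ n) := fun k =>
    (siteHom k).comp (E.symm : SpinAlg (Fin n) 2 →⋆ₐ[ℂ] Mat (2 ^ n))
  let f : ℕ → Mat 2 →⋆ₐ[ℂ] SpinAlg K (2 ^ n) := fun k => (j (e k).1).comp (siteHom (e k).2)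
  have hf : CommutingFamily f := by
    intro k l h m m'
    by_cases h1 : (e k).1 = (e l).1
    · have h2 : (e k).2 ≠ (e l).2 := fun h2 => h (e.injective (Prod.ext h1 h2))
      simp only [f, h1]
      exact (commutingFamily_siteHom _ _ h2 m m').map (j (e l).1)
    · exact commutingFamily_siteHom _ _ h1 _ _
  have hgen : TopologicallyGenerates (Set.range fun x : ℕ × Mat 2 => f x.1 x.2) := by
    intro T hT hS
    -- The qubits of block `k` generate the whole matrix algebra at the site `k`.
    have h1 : ∀ k, T.comap (j k) = ⊤ := by
      intro k
      refine generates_site _ (hT.preimage (j k).continuous_of_cstar) ?_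
      rintro _ ⟨x, rfl⟩
      refine hS ⟨(e.symm (k, x.1), x.2), ?_⟩
      simp only [f, Equiv.apply_symm_apply]
      rfl
    refine generates_site _ hT ?_
    rintro _ ⟨x, rfl⟩
    have h2 : E x.2 ∈ T.comap (j x.1) := h1 x.1 ▸ StarSubalgebra.mem_top
    have h3 : j x.1 (E x.2) = site x.1 x.2 := congrArg (siteHom x.1) (E.symm_apply_apply x.2)
    change site x.1 x.2 ∈ T
    rw [← h3]
    exact h2
  exact ⟨(equivOfGenerates f hf hgen).symm⟩

end SpinAlg

/-! ### Product states -/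

/-- The state obtained by pulling back along a unital `*`-homomorphism. -/
def AbstractState.comp {A B : Type*} [CStarAlgebra A] [CStarAlgebra B] (s : AbstractState B)
    (f : A →⋆ₐ[ℂ] B) : AbstractState A where
  toLinearMap := s.toLinearMap.comp f.toAlgHom.toLinearMap
  nonneg a := by
    change 0 ≤ s (f (star a * a))
    rw [map_mul, map_star]
    exact s.nonneg _
  map_one := by
    change s (f 1) = 1
    rw [_root_.map_one, s.map_one]

theorem AbstractState.comp_apply {A B : Type*} [CStarAlgebra A] [CStarAlgebra B]
    (s : AbstractState B) (f : A →⋆ₐ[ℂ] B) (a : A) : s.comp f a = s (f a) := rfl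

/-! ### Normal form of words in commuting monoids -/

section Words

variable {I S C : Type*} [Monoid S] [Monoid C] {h : I → S →* C}

/-- Letters with different indices commute and letters with the same index merge, so each index need
occur only once. Induction multiplies by one letter on the left. -/
theorem exists_prod_of_mem_closure (hc : ∀ i j, i ≠ j → ∀ s t, Commute (h i s) (h j t)) {z : C}
    (hz : z ∈ Submonoid.closure (Set.range fun x : I × S => h x.1 x.2)) :
    ∃ (l : List I) (_ : l.Nodup) (M : I → S), z = (l.map fun i => h i (M i)).prod := by
  classical
  induction hz using Submonoid.closure_induction_left with
  | one => exact ⟨[], List.nodup_nil, fun _ => 1, rfl⟩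
  | mul_left x hx y hy ih =>
    obtain ⟨⟨i, s⟩, rfl⟩ := hx
    obtain ⟨l, hl, M, rfl⟩ := ih
    -- Any letter already present at the index `i` is brought to the front, ready to merge with the
    -- new one; if there is none, `c = 1`.
    have key : ∃ c, (l.map fun j => h j (M j)).prod =
        h i c * ((l.erase i).map fun j => h j (M j)).prod := by
      by_cases hi : i ∈ l
      · refine ⟨M i, ?_⟩
        rw [((List.perm_cons_erase hi).map fun j => h j (M j)).prod_eq', List.map_cons,
          List.prod_cons]
        exact List.pairwise_map.2 (hl.imp fun hne => hc _ _ hne _ _)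
      · exact ⟨1, by rw [List.erase_of_not_mem hi, map_one, one_mul]⟩
    obtain ⟨c, hkey⟩ := key
    have hni : i ∉ l.erase i := fun hi => (hl.mem_erase_iff.1 hi).1 rfl
    refine ⟨i :: l.erase i, List.nodup_cons.2 ⟨hni, hl.erase i⟩, Function.update M i (s * c), ?_⟩
    rw [hkey, List.map_cons, List.prod_cons, Function.update_self, map_mul, mul_assoc]
    congr 3
    refine List.map_congr_left fun j hj => ?_
    rw [Function.update_of_ne]
    rintro rfl
    exact hni hj

end Words

theorem MaxTensor.star_tmul {A B : Type*} [CStarAlgebra A] [CStarAlgebra B] (a : A) (b : B) :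
    star (tmul a b) = tmul (star a) (star b) := by
  rw [tmul, ← map_star, TensorProduct.star_tmul, tmul]

theorem MaxTensor.tmul_list_prod {A B ι : Type*} [CStarAlgebra A] [CStarAlgebra B] (l : List ι)
    (f : ι → A) (g : ι → B) :
    MaxTensor.tmul (l.map f).prod (l.map g).prod = (l.map fun x => tmul (f x) (g x)).prod := by
  induction l with
  | nil => exact tmul_one_one
  | cons x l ih => simp only [List.map_cons, List.prod_cons, ← ih, tmul_mul_tmul]

namespace SpinAlg

/-! ### Functionals are determined by product elements -/

section Uniqueness

variable {I : Type} {d : ℕ} [NeZero d]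

/-- A continuous functional on the two-party algebra is determined by its values on products. -/
theorem functional_ext {f g : MaxTensor (SpinAlg I d) (SpinAlg I d) →ₗ[ℂ] ℂ} (hf : Continuous f)
    (hg : Continuous g)
    (h : ∀ (l : List I) (_ : l.Nodup) (M N : I → Mat d),
      f (.tmul (l.map fun x => site x (M x)).prod (l.map fun x => site x (N x)).prod) =
        g (.tmul (l.map fun x => site x (M x)).prod (l.map fun x => site x (N x)).prod)) :
    f = g := by
  -- Bundling the matrices of both parties at one site turns a pair of words into a single word.
  -- This map is multiplicative but not linear, hence only a monoid homomorphism.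
  let k : I → Mat d × Mat d →* MaxTensor (SpinAlg I d) (SpinAlg I d) := fun i =>
    { toFun := fun m => .tmul (siteHom i m.1) (siteHom i m.2)
      map_one' := by simp [MaxTensor.tmul_one_one]
      map_mul' := fun m m' => by simp [MaxTensor.tmul_mul_tmul] }
  have hc : ∀ i j, i ≠ j → ∀ s t, Commute (k i s) (k j t) := by
    intro i j hij s t
    change MaxTensor.tmul _ _ * MaxTensor.tmul _ _ = MaxTensor.tmul _ _ * MaxTensor.tmul _ _
    rw [MaxTensor.tmul_mul_tmul, MaxTensor.tmul_mul_tmul,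
      (commutingFamily_siteHom i j hij s.1 t.1).eq, (commutingFamily_siteHom i j hij s.2 t.2).eq]
  let R := Set.range fun x : I × (Mat d × Mat d) => k x.1 x.2
  have hR : R ∪ star R = R := by
    refine Set.union_eq_left.2 ?_
    rintro x ⟨⟨i, m⟩, hx⟩
    refine ⟨(i, star m), ?_⟩
    rw [← star_star x, ← hx]
    change MaxTensor.tmul (siteHom i (star m.1)) (siteHom i (star m.2)) =
      star (MaxTensor.tmul (siteHom i m.1) (siteHom i m.2))
    rw [MaxTensor.star_tmul, map_star, map_star]
  have htop : (StarAlgebra.adjoin ℂ R).topologicalClosure = ⊤ := by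
    refine (MaxTensor.generates_tmul (A := SpinAlg I d) (B := SpinAlg I d) generates_site
      generates_site) _
      (StarSubalgebra.isClosed_topologicalClosure _) ?_
    refine subset_trans ?_ ((StarAlgebra.subset_adjoin ℂ R).trans
      (StarSubalgebra.le_topologicalClosure _))
    rintro _ (⟨_, ⟨x, rfl⟩, rfl⟩ | ⟨_, ⟨x, rfl⟩, rfl⟩)
    · exact ⟨(x.1, (x.2, 1)), congrArg (MaxTensor.tmul (site x.1 x.2)) (map_one (siteHom x.1))⟩
    · exact ⟨(x.1, (1, x.2)),
        congrArg (fun y => MaxTensor.tmul y (site x.1 x.2)) (map_one (siteHom x.1))⟩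
  -- As `R` is closed under `star`, the algebra it generates is the linear span of the words in `R`,
  -- and these have the normal form with distinct sites.
  have hon : ∀ z ∈ StarAlgebra.adjoin ℂ R, f z = g z := by
    intro z hz
    have hz' : z ∈ Submodule.span ℂ (Submonoid.closure (R ∪ star R) : Set _) := by
      rw [← StarAlgebra.adjoin_eq_span]
      exact hz
    rw [hR] at hz'
    refine LinearMap.eqOn_span (f := f) (g := g) (fun z hz => ?_) hz'
    obtain ⟨l, hl, M, rfl⟩ := exists_prod_of_mem_closure hc hz
    have := h l hl (fun x => (M x).1) (fun x => (M x).2)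
    rwa [MaxTensor.tmul_list_prod] at this
  refine LinearMap.ext fun z => ?_
  have hz : z ∈ closure (StarAlgebra.adjoin ℂ R : Set _) := by
    rw [← StarSubalgebra.topologicalClosure_coe, htop]
    trivial
  exact closure_minimal (t := {z | f z = g z}) hon (isClosed_eq hf hg) hz

end Uniqueness

/-! ### The vacuum state and its factorization -/

section Vacuum

variable {I : Type} {d : ℕ} [NeZero d]

-- Matrix elements of a product operator factorize, with a Kronecker delta at the sites it does not
-- touch. The configuration `c` must vary in the induction, because the first operator sums over its
-- updates.
open Classical in
theorem val_prod_configVec (l : List I) (hl : l.Nodup) (A : I → Mat d) (b c : I →₀ Fin d) :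
    val I d (l.map fun x => site x (A x)).prod (configVec b) c =
      (l.map fun x => A x (c x) (b x)).prod * if ∀ y ∉ l, c y = b y then 1 else 0 := by
  induction l generalizing c with
  | nil => simp [configVec_apply, DFunLike.ext_iff]
  | cons i l ih =>
    obtain ⟨hi, hl⟩ := List.nodup_cons.1 hl
    rw [List.map_cons, List.prod_cons, map_mul, mul_apply_eq_comp, val_site, siteOp_apply]
    simp only [ih hl]
    have h1 : ∀ k, (l.map fun x => A x ((c.update i k) x) (b x)) =
        l.map fun x => A x (c x) (b x) := fun k => List.map_congr_left fun x hx => by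
      rw [Finsupp.update_apply, if_neg (by rintro rfl; exact hi hx)]
    have h2 : ∀ k, (∀ y ∉ l, (c.update i k) y = b y) ↔ k = b i ∧ ∀ y ∉ i :: l, c y = b y := by
      intro k
      constructor
      · intro h
        refine ⟨by simpa using h i hi, fun y hy => ?_⟩
        rw [List.mem_cons, not_or] at hy
        simpa [Finsupp.update_apply, hy.1] using h y hy.2
      · rintro ⟨rfl, h⟩ y hy
        rw [Finsupp.update_apply]
        split_ifs with hyi
        · rw [hyi]
        · exact h y (by simp [hyi, hy])
    simp only [h1, h2, ite_and, mul_ite, mul_zero, Finset.sum_ite_eq', Finset.mem_univ, if_true,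
      List.map_cons, List.prod_cons, mul_one]

variable (I d) in
/-- The vacuum state, given by the configuration that vanishes everywhere. -/
def vacuum : AbstractState (SpinAlg I d) where
  toLinearMap :=
    { toFun := fun x => inner ℂ (configVec 0) (val I d x (configVec 0))
      map_add' := fun x y => by rw [map_add, add_apply, inner_add_right]
      map_smul' := fun c x => by rw [map_smul, smul_apply, inner_smul_right]; rfl }
  nonneg x := by
    change 0 ≤ inner ℂ (configVec 0) (val I d (star x * x) (configVec 0))
    rw [map_mul, map_star, mul_apply_eq_comp, ContinuousLinearMap.star_eq_adjoint,
      ContinuousLinearMap.adjoint_inner_right, inner_self_eq_norm_sq_to_K]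
    have h := Complex.zero_le_real.2 (sq_nonneg ‖val I d x (configVec 0)‖)
    rwa [Complex.ofReal_pow] at h
  map_one := by
    change inner ℂ (configVec 0) (val I d 1 (configVec 0)) = 1
    rw [map_one, one_apply_eq_self, inner_configVec, configVec_apply, if_pos rfl]

theorem vacuum_apply (x : SpinAlg I d) : vacuum I d x = val I d x (configVec 0) 0 :=
  inner_configVec _ _

theorem continuous_vacuum : Continuous (vacuum I d) := by
  have h : Continuous fun x : SpinAlg I d => val I d x (configVec 0) :=
    (ContinuousLinearMap.apply ℂ _ (configVec 0)).continuous.comp isometry_val.continuous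
  exact continuous_const.inner h

theorem vacuum_prod (l : List I) (hl : l.Nodup) (A : I → Mat d) :
    vacuum I d (l.map fun x => site x (A x)).prod = (l.map fun x => A x 0 0).prod := by
  classical
  rw [vacuum_apply, val_prod_configVec l hl]
  simp

end Vacuum

end SpinAlg

/-- A partially defined orthonormal family of columns extends to a unitary matrix. -/
theorem exists_unitary_of_orthonormal {J : Type*} [Fintype J] [DecidableEq J]
    (v : J → EuclideanSpace ℂ J) (s : Set J) (hv : Orthonormal ℂ (s.domRestrict v)) :
    ∃ u : unitary (CStarMatrix J J ℂ), ∀ j ∈ s, ∀ a, (u : CStarMatrix J J ℂ) a j = v j a := by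
  obtain ⟨b, hb⟩ := hv.exists_orthonormalBasis_extension_of_card_eq (by simp)
  let u : CStarMatrix J J ℂ := CStarMatrix.ofMatrix fun a j => b j a
  have h1 : star u * u = 1 := by
    ext i j
    rw [CStarMatrix.mul_apply, CStarMatrix.one_apply, ← b.inner_eq_ite i j, PiLp.inner_apply]
    refine Finset.sum_congr rfl fun a _ => ?_
    rw [CStarMatrix.star_apply]
    exact mul_comm _ _
  have h2 : u * star u = 1 := (mul_eq_one_comm (M := Matrix J J ℂ)).1 h1
  exact ⟨⟨u, Unitary.mem_iff.2 ⟨h1, h2⟩⟩, fun j hj a => by rw [← hb j hj]; rfl⟩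

theorem exists_unitary_column {J : Type*} [Fintype J] [DecidableEq J] (j : J)
    (φ : EuclideanSpace ℂ J) (hφ : ‖φ‖ = 1) :
    ∃ u : unitary (CStarMatrix J J ℂ), ∀ a, (u : CStarMatrix J J ℂ) a j = φ a := by
  obtain ⟨u, hu⟩ := exists_unitary_of_orthonormal (fun _ => φ) {j}
    ⟨fun _ => hφ, fun a b hab => absurd (Subsingleton.elim a b) hab⟩
  exact ⟨u, hu j rfl⟩

/-! ### The two parties at one site, inside `Mat (d * d)` -/

section Pairs

variable {d : ℕ} [NeZero d]

instance : NeZero (d * d) := ⟨mul_ne_zero (NeZero.ne d) (NeZero.ne d)⟩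

/-- The matrix `m ⊗ m'`. -/
def pairMat (m m' : Mat d) : Mat (d * d) :=
  CStarMatrix.ofMatrix (Matrix.reindex finProdFinEquiv finProdFinEquiv
    (Matrix.kroneckerMap (· * ·) (CStarMatrix.ofMatrix.symm m) (CStarMatrix.ofMatrix.symm m')))

theorem pairMat_apply (m m' : Mat d) (x y : Fin d × Fin d) :
    pairMat m m' (finProdFinEquiv x) (finProdFinEquiv y) = m x.1 y.1 * m' x.2 y.2 := by
  simp [pairMat, CStarMatrix.ofMatrix_apply, Matrix.reindex_apply, Matrix.submatrix_apply]

theorem pairMat_ext {A B : Mat (d * d)}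
    (h : ∀ x y, A (finProdFinEquiv x) (finProdFinEquiv y) =
      B (finProdFinEquiv x) (finProdFinEquiv y)) :
    A = B := by
  ext i j
  obtain ⟨x, rfl⟩ := finProdFinEquiv.surjective i
  obtain ⟨y, rfl⟩ := finProdFinEquiv.surjective j
  exact h x y

theorem pairMat_mul (m m' k k' : Mat d) :
    pairMat m m' * pairMat k k' = pairMat (m * k) (m' * k') := by
  refine pairMat_ext fun x y => ?_
  rw [CStarMatrix.mul_apply, ← finProdFinEquiv.sum_comp, pairMat_apply, CStarMatrix.mul_apply,
    CStarMatrix.mul_apply, Finset.sum_mul_sum, Fintype.sum_prod_type]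
  refine Finset.sum_congr rfl fun a _ => Finset.sum_congr rfl fun b _ => ?_
  rw [pairMat_apply, pairMat_apply]
  ring

theorem pairMat_one : pairMat (1 : Mat d) 1 = 1 := by
  refine pairMat_ext fun x y => ?_
  rw [pairMat_apply]
  simp only [CStarMatrix.one_apply, EmbeddingLike.apply_eq_iff_eq, Prod.ext_iff, ite_and]
  split_ifs <;> simp

theorem pairMat_star (m m' : Mat d) : pairMat (star m) (star m') = star (pairMat m m') := by
  refine pairMat_ext fun x y => ?_
  rw [pairMat_apply, CStarMatrix.star_apply, CStarMatrix.star_apply, CStarMatrix.star_apply,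
    pairMat_apply, star_mul']

/-- The homomorphism `m ↦ m ⊗ 1`. -/
def pairLeft : Mat d →⋆ₐ[ℂ] Mat (d * d) where
  toFun m := pairMat m 1
  map_one' := pairMat_one
  map_mul' m k := by rw [pairMat_mul, one_mul]
  map_zero' := pairMat_ext fun x y => by
    rw [pairMat_apply, CStarMatrix.zero_apply, CStarMatrix.zero_apply, zero_mul]
  map_add' m k := pairMat_ext fun x y => by
    simp only [pairMat_apply, CStarMatrix.add_apply, add_mul]
  commutes' c := by
    rw [Algebra.algebraMap_eq_smul_one, Algebra.algebraMap_eq_smul_one, ← pairMat_one]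
    exact pairMat_ext fun x y => by
      simp only [pairMat_apply, CStarMatrix.smul_apply, smul_eq_mul, mul_assoc]
  map_star' m := by rw [← pairMat_star, star_one]

/-- The homomorphism `m ↦ 1 ⊗ m`. -/
def pairRight : Mat d →⋆ₐ[ℂ] Mat (d * d) where
  toFun m := pairMat 1 m
  map_one' := pairMat_one
  map_mul' m k := by rw [pairMat_mul, one_mul]
  map_zero' := pairMat_ext fun x y => by
    rw [pairMat_apply, CStarMatrix.zero_apply, CStarMatrix.zero_apply, mul_zero]
  map_add' m k := pairMat_ext fun x y => by
    simp only [pairMat_apply, CStarMatrix.add_apply, mul_add]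
  commutes' c := by
    rw [Algebra.algebraMap_eq_smul_one, Algebra.algebraMap_eq_smul_one, ← pairMat_one]
    exact pairMat_ext fun x y => by
      simp only [pairMat_apply, CStarMatrix.smul_apply, smul_eq_mul, mul_left_comm]
  map_star' m := by rw [← pairMat_star, star_one]

theorem pairLeft_mul_pairRight (m m' : Mat d) : pairLeft m * pairRight m' = pairMat m m' := by
  change pairMat m 1 * pairMat 1 m' = _
  rw [pairMat_mul, mul_one, one_mul]

theorem commute_pair (m m' : Mat d) : Commute (pairLeft m) (pairRight m') := by
  rw [commute_iff_eq, pairLeft_mul_pairRight]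
  change _ = pairMat 1 m' * pairMat m 1
  rw [pairMat_mul, mul_one, one_mul]

/-- Expectation values of `φ` are vacuum expectation values after a rotation. -/
theorem exists_unitary_expect (φ : Bipartite d) (hφ : ‖φ‖ = 1) :
    ∃ u : unitary (Mat (d * d)), ∀ m m' : Mat d,
      Unitary.conjStarAlgAut ℂ (Mat (d * d)) u⁻¹ (pairMat m m') 0 0 = expect φ m m' := by
  -- With `φ` as column `0` of `u`, the `(0, 0)` entry of `u* X u` is ⟨φ|X|φ⟩.
  obtain ⟨u, hu⟩ := exists_unitary_column (0 : Fin (d * d))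
    (LinearIsometryEquiv.piLpCongrLeft 2 ℂ ℂ finProdFinEquiv φ)
    (by rw [LinearIsometryEquiv.norm_map, hφ])
  refine ⟨u, fun m m' => ?_⟩
  have hu' : ∀ x, (u : Mat (d * d)) (finProdFinEquiv x) 0 = φ x := fun x => by
    rw [hu, LinearIsometryEquiv.piLpCongrLeft_apply]
    simp
  have h : Unitary.conjStarAlgAut ℂ (Mat (d * d)) u⁻¹ (pairMat m m') =
      star (u : Mat (d * d)) * pairMat m m' * u := Unitary.conjStarAlgAut_star_apply u _
  rw [h, CStarMatrix.mul_apply, expect, Finset.sum_comm, ← finProdFinEquiv.sum_comp]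
  refine Finset.sum_congr rfl fun y _ => ?_
  rw [CStarMatrix.mul_apply, ← finProdFinEquiv.sum_comp, Finset.sum_mul]
  refine Finset.sum_congr rfl fun x _ => ?_
  rw [CStarMatrix.star_apply, hu', hu', pairMat_apply]

end Pairs

/-! ### Existence of product states -/

namespace SpinAlg

variable {I : Type} {d : ℕ} [NeZero d]

/-- The infinite product of a family of pure two-party states. -/
theorem exists_productState (φ : I → Bipartite d) (hφ : ∀ i, ‖φ i‖ = 1) :
    ∃ s : AbstractState (MaxTensor (SpinAlg I d) (SpinAlg I d)), Continuous s ∧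
      ∀ (l : List I) (_ : l.Nodup) (M N : I → Mat d),
        s (.tmul (l.map fun x => site x (M x)).prod (l.map fun x => site x (N x)).prod) =
          (l.map fun x => expect (φ x) (M x) (N x)).prod := by
  choose u hu using fun i => exists_unitary_expect (φ i) (hφ i)
  -- The copy of `Mat (d * d)` at each site is rotated so that the vacuum looks like `φ i` there. No
  -- infinite product of the unitaries is needed, since the universal property uses one site at a
  -- time.
  let r : I → Mat (d * d) →⋆ₐ[ℂ] SpinAlg I (d * d) := fun i =>
    (siteHom i).comp (Unitary.conjStarAlgAut ℂ (Mat (d * d)) (u i)⁻¹ :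
      Mat (d * d) →⋆ₐ[ℂ] Mat (d * d))
  have hr : CommutingFamily r := fun i j h m m' => commutingFamily_siteHom i j h _ _
  have hL : CommutingFamily fun i => (r i).comp pairLeft := fun i j h m m' => hr i j h _ _
  have hR : CommutingFamily fun i => (r i).comp pairRight := fun i j h m m' => hr i j h _ _
  have hLR : ∀ i j m m', Commute (r i (pairLeft m)) (r j (pairRight m')) := by
    intro i j m m'
    rcases eq_or_ne i j with rfl | h
    · exact (commute_pair m m').map (r i)
    · exact hr i j h _ _
  have hc : ∀ a b, Commute (lift _ hL a) (lift _ hR b) := by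
    intro a b
    refine commute_lift _ _ (fun j m' => ?_) (fun j m' => ?_) b
    · exact (commute_lift _ _ (fun i m => (hLR i j m m').symm) (fun i m => by
        rw [← map_star]
        exact (hLR i j m _).symm) a).symm
    · rw [← map_star]
      exact (commute_lift _ _ (fun i m => (hLR i j m m').symm) (fun i m => by
        rw [← map_star]
        exact (hLR i j m _).symm) (star a)).symm
  -- Alice acts on the left and Bob on the right half of every site; these actions commute, so they
  -- represent the maximal tensor product.
  let π := MaxTensor.liftCommute (lift _ hL) (lift _ hR) hc
  refine ⟨(vacuum I (d * d)).comp π, continuous_vacuum.comp π.continuous_of_cstar, ?_⟩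
  intro l hl M N
  rw [AbstractState.comp_apply, MaxTensor.tmul_list_prod, map_list_prod, List.map_map]
  have h1 : ∀ x, (π ∘ fun x => .tmul (site x (M x)) (site x (N x))) x =
      site x (Unitary.conjStarAlgAut ℂ (Mat (d * d)) (u x)⁻¹ (pairMat (M x) (N x))) := by
    intro x
    simp only [Function.comp, π, MaxTensor.liftCommute_tmul, lift_site]
    rw [← pairLeft_mul_pairRight, map_mul]
    exact (map_mul (siteHom x) _ _).symm
  rw [List.map_congr_left fun x _ => h1 x, vacuum_prod l hl]
  exact congrArg List.prod (List.map_congr_left fun x _ => hu x _ _)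

end SpinAlg

/-! ### Expectation values -/

section Expect

variable {d : ℕ}

open scoped Kronecker in
theorem expect_eq_dotProduct (φ : Bipartite d) (m m' : Mat d) :
    expect φ m m' = star φ.ofLp ⬝ᵥ
      (((CStarMatrix.ofMatrix.symm m) ⊗ₖ (CStarMatrix.ofMatrix.symm m')).mulVec φ.ofLp) := by
  simp only [expect, dotProduct, Matrix.mulVec, Finset.mul_sum, Pi.star_apply,
    Matrix.kroneckerMap_apply, mul_assoc]
  rfl

open scoped Kronecker in
theorem localUnitary_ofLp (U V : unitary (Mat d)) (φ : Bipartite d) :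
    (localUnitary U V φ).ofLp = ((CStarMatrix.ofMatrix.symm (U : Mat d)) ⊗ₖ
      (CStarMatrix.ofMatrix.symm (V : Mat d))).mulVec φ.ofLp := rfl

-- Passage to the Heisenberg picture: local unitaries on the vector become conjugations of the
-- observables.
open scoped Kronecker in
theorem expect_localUnitary (U V : unitary (Mat d)) (φ : Bipartite d) (m m' : Mat d) :
    expect (localUnitary U V φ) m m' =
      expect φ (Unitary.conjStarAlgAut ℂ (Mat d) U⁻¹ m)
        (Unitary.conjStarAlgAut ℂ (Mat d) V⁻¹ m') := by
  have h : ∀ (W : unitary (Mat d)) (k : Mat d),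
      CStarMatrix.ofMatrix.symm (Unitary.conjStarAlgAut ℂ (Mat d) W⁻¹ k) =
        (CStarMatrix.ofMatrix.symm (W : Mat d)).conjTranspose * CStarMatrix.ofMatrix.symm k *
          CStarMatrix.ofMatrix.symm (W : Mat d) := fun W k =>
    Unitary.conjStarAlgAut_star_apply (S := ℂ) W k
  rw [expect_eq_dotProduct, expect_eq_dotProduct, h, h, localUnitary_ofLp,
    Matrix.mul_kronecker_mul, Matrix.mul_kronecker_mul, ← Matrix.mulVec_mulVec,
    ← Matrix.mulVec_mulVec, Matrix.star_mulVec, ← Matrix.dotProduct_mulVec,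
    Matrix.conjTranspose_kronecker]

/-- The norm is itself an expectation value, so the invariance of norms under local unitaries comes
from the Heisenberg picture. -/
theorem expect_one_one (φ : Bipartite d) : expect φ 1 1 = ((‖φ‖ ^ 2 : ℝ) : ℂ) := by
  rw [EuclideanSpace.norm_sq_eq, Complex.ofReal_sum, expect]
  refine Finset.sum_congr rfl fun x _ => ?_
  have h : ∀ y : Fin d × Fin d, star (φ x) * ((1 : Mat d) x.1 y.1 * (1 : Mat d) x.2 y.2) * φ y =
      if x = y then star (φ x) * φ y else 0 := fun y => by
    simp only [CStarMatrix.one_apply, Prod.ext_iff, ite_and]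
    split_ifs <;> simp
  simp only [h, Finset.sum_ite_eq, Finset.mem_univ, if_true]
  rw [Complex.ofReal_pow]
  exact Complex.conj_mul' (φ x)

theorem norm_localUnitary (U V : unitary (Mat d)) (φ : Bipartite d) :
    ‖localUnitary U V φ‖ = ‖φ‖ := by
  have h : expect (localUnitary U V φ) 1 1 = expect φ 1 1 := by
    rw [expect_localUnitary, map_one, map_one]
  rw [expect_one_one, expect_one_one, Complex.ofReal_inj] at h
  exact (sq_eq_sq₀ (norm_nonneg _) (norm_nonneg _)).1 h

theorem norm_ket00 [NeZero d] : ‖ket00 d‖ = 1 := by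
  rw [ket00, EuclideanSpace.single, PiLp.norm_single, norm_one]

theorem norm_schmidtState {n : ℕ} (q : EuclideanSpace ℝ (Fin (2 ^ n))) :
    ‖schmidtState q‖ = ‖q‖ := by
  refine (sq_eq_sq₀ (norm_nonneg _) (norm_nonneg _)).1 ?_
  rw [EuclideanSpace.norm_sq_eq, EuclideanSpace.norm_sq_eq, Fintype.sum_prod_type]
  refine Finset.sum_congr rfl fun i _ => ?_
  rw [Finset.sum_eq_single i]
  · simp [schmidtState]
  · intro j _ hj
    simp [schmidtState, hj.symm]
  · simp

end Expect

/-! ### Embezzlement by permutations of sites -/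

namespace SpinAlg

variable {I : Type} {d : ℕ} [NeZero d]

/-- `s` is the infinite product of the two-party pure states `φ i`. -/
def IsProductState (φ : I → Bipartite d)
    (s : AbstractState (MaxTensor (SpinAlg I d) (SpinAlg I d))) : Prop :=
  Continuous s ∧ ∀ (l : List I) (_ : l.Nodup) (M N : I → Mat d),
    s (.tmul (l.map fun x => site x (M x)).prod (l.map fun x => site x (N x)).prod) =
      (l.map fun x => expect (φ x) (M x) (N x)).prod

theorem optionEquiv_relabel_mul (a : SpinAlg I d) (m : Mat d) :
    optionEquiv I d (relabel some (Option.some_injective I) a * site none m) = .tmul a m := by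
  have h : ((optionEquiv I d : SpinAlg (Option I) d →⋆ₐ[ℂ] _).comp
      (relabel some (Option.some_injective I))) = MaxTensor.inclLeft :=
    hom_ext fun i m => by
      simp only [StarAlgHom.comp_apply, relabel_site]
      exact optionEquiv_some i m
  rw [map_mul, optionEquiv_none, MaxTensor.tmul_eq a]
  exact congrArg (· * MaxTensor.inclRight m) (DFunLike.congr_fun h a)

variable (I d) in
/-- The inverse of `optionEquiv` as a `*`-homomorphism. -/
def optionHom : MaxTensor (SpinAlg I d) (Mat d) →⋆ₐ[ℂ] SpinAlg (Option I) d :=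
  ((optionEquiv I d).symm : MaxTensor (SpinAlg I d) (Mat d) →⋆ₐ[ℂ] SpinAlg (Option I) d)

theorem optionHom_tmul (a : SpinAlg I d) (m : Mat d) :
    optionHom I d (.tmul a m) = relabel some (Option.some_injective I) a * site none m :=
  (optionEquiv I d).symm_apply_eq.2 (optionEquiv_relabel_mul a m).symm

/-- A product state with one further site `none` is the joint state: this constructs `s ⊗ s_ψ`
without tensoring states. For fixed `m`, `m'` both sides are continuous functionals of the catalyst
part, hence determined by product elements. -/
theorem IsProductState.isJointState {φ : I → Bipartite d}
    {s : AbstractState (MaxTensor (SpinAlg I d) (SpinAlg I d))} (hs : IsProductState φ s)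
    {ψ : Bipartite d} {S : AbstractState (MaxTensor (SpinAlg (Option I) d) (SpinAlg (Option I) d))}
    (hS : IsProductState (fun x => Option.elim x ψ φ) S) :
    IsJointState s ψ (S.comp (MaxTensor.map (optionHom I d) (optionHom I d))) := by
  intro a b m m'
  rw [AbstractState.comp_apply, MaxTensor.map_tmul, optionHom_tmul, optionHom_tmul,
    ← MaxTensor.tmul_mul_tmul]
  let r : SpinAlg I d →⋆ₐ[ℂ] SpinAlg (Option I) d := relabel some (Option.some_injective I)
  let t : MaxTensor (SpinAlg (Option I) d) (SpinAlg (Option I) d) :=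
    .tmul (site none m) (site none m')
  have hF : S.toLinearMap ∘ₗ LinearMap.mulRight ℂ t ∘ₗ (MaxTensor.map r r).toAlgHom.toLinearMap =
      (LinearMap.mulRight ℂ (expect ψ m m')) ∘ₗ s.toLinearMap := by
    refine functional_ext ?_ ?_ ?_
    · exact hS.1.comp ((MaxTensor.map r r).continuous_of_cstar.mul continuous_const)
    · exact hs.1.mul continuous_const
    · intro l hl M N
      have h2 : ∀ M : I → Mat d, ∀ m, r (l.map fun x => site x (M x)).prod * site none m =
          ((l.map some ++ [none]).map fun x => site x (Option.elim x m M)).prod := by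
        intro M m
        rw [map_list_prod, List.map_map, List.map_append, List.prod_append, List.map_map]
        simp only [List.map_cons, List.map_nil, List.prod_cons, List.prod_nil, mul_one]
        refine congrArg (fun x => List.prod x * _) (List.map_congr_left fun x _ => ?_)
        exact relabel_site _ _ _ _
      change S (MaxTensor.map r r (.tmul _ _) * t) = s _ * expect ψ m m'
      rw [MaxTensor.map_tmul, MaxTensor.tmul_mul_tmul, h2, h2, hs.2 l hl, hS.2, List.map_append,
        List.prod_append, List.map_map]
      · simp [Function.comp_def]
      · refine List.nodup_append.2 ⟨hl.map (Option.some_injective I), by simp, ?_⟩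
        simp
  have h3 : S (MaxTensor.map r r (.tmul a b) * t) = s (.tmul a b) * expect ψ m m' :=
    DFunLike.congr_fun hF (.tmul a b)
  rwa [MaxTensor.map_tmul] at h3

/-- If two local automorphisms permute the sites, including the external one, and modify the
external factor, then they embezzle any state with the matching expectation values. -/
theorem IsProductState.embezzles {φ : I → Bipartite d}
    {s : AbstractState (MaxTensor (SpinAlg I d) (SpinAlg I d))} (hs : IsProductState φ s)
    (hφ : ∀ i, ‖φ i‖ = 1) {ψ : Bipartite d} (hψ : ‖ψ‖ = 1) (ρ : Equiv.Perm (Option I))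
    (A B : Mat d → Mat d) (α β : MaxTensor (SpinAlg I d) (Mat d) ≃⋆ₐ[ℂ]
      MaxTensor (SpinAlg I d) (Mat d))
    (hα : ∀ i m, α (.tmul (site i m) 1) = optionEquiv I d (site (ρ (some i)) m))
    (hα' : ∀ m, α (.tmul 1 m) = optionEquiv I d (site (ρ none) (A m)))
    (hβ : ∀ i m, β (.tmul (site i m) 1) = optionEquiv I d (site (ρ (some i)) m))
    (hβ' : ∀ m, β (.tmul 1 m) = optionEquiv I d (site (ρ none) (B m)))
    (hρ : ∀ i, Option.elim (ρ (some i)) (ket00 d) φ = φ i)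
    (hρ' : ∀ m m', expect (Option.elim (ρ none) (ket00 d) φ) (A m) (B m') = expect ψ m m') :
    Embezzles s α β ψ := by
  obtain ⟨S₀, hS₀⟩ := exists_productState (fun x : Option I => Option.elim x (ket00 d) φ)
    (by rintro (_ | i); exacts [norm_ket00, hφ i])
  obtain ⟨S, hS⟩ := exists_productState (fun x : Option I => Option.elim x ψ φ)
    (by rintro (_ | i); exacts [hψ, hφ i])
  refine ⟨_, _, hs.isJointState hS₀, hs.isJointState hS, fun X => ?_⟩
  let Θ := optionEquiv I d
  let α' : SpinAlg (Option I) d →⋆ₐ[ℂ] SpinAlg (Option I) d :=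
    ((Θ.trans α).trans Θ.symm : _ ≃⋆ₐ[ℂ] _)
  let β' : SpinAlg (Option I) d →⋆ₐ[ℂ] SpinAlg (Option I) d :=
    ((Θ.trans β).trans Θ.symm : _ ≃⋆ₐ[ℂ] _)
  -- After the external factor is absorbed as the site `none`, the embezzlement identity compares
  -- two continuous functionals on a spin system, so products suffice.
  have hkey : (S₀.comp (MaxTensor.map α' β')).toLinearMap = S.toLinearMap := by
    refine functional_ext (hS₀.1.comp (MaxTensor.map α' β').continuous_of_cstar) hS.1 ?_
    intro l hl M N
    have h1 : ∀ (γ : MaxTensor (SpinAlg I d) (Mat d) ≃⋆ₐ[ℂ] MaxTensor (SpinAlg I d) (Mat d))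
        (A : Mat d → Mat d) (γ' : SpinAlg (Option I) d →⋆ₐ[ℂ] SpinAlg (Option I) d)
        (_ : γ' = ((Θ.trans γ).trans Θ.symm : _ ≃⋆ₐ[ℂ] _))
        (_ : ∀ i m, γ (.tmul (site i m) 1) = optionEquiv I d (site (ρ (some i)) m))
        -- The matrix of `x` ends up at `ρ x`, so the site `y` carries the matrix of `ρ.symm y`,
        -- modified by `A` only if it came from the external site.
        (_ : ∀ m, γ (.tmul 1 m) = optionEquiv I d (site (ρ none) (A m))) (M : Option I → Mat d),
        γ' (l.map fun x => site x (M x)).prod = ((l.map ρ).map fun x =>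
          site x (Option.elim (ρ.symm x) (A (M none)) fun i => M (some i))).prod := by
      rintro γ A _ rfl h h' M
      rw [map_list_prod, List.map_map, List.map_map]
      refine congrArg List.prod (List.map_congr_left fun x _ => ?_)
      refine Θ.symm_apply_eq.2 ?_
      simp only [Function.comp, Equiv.symm_apply_apply]
      cases x with
      | none => exact (congrArg γ (optionEquiv_none _)).trans (h' _)
      | some i => exact (congrArg γ (optionEquiv_some _ _)).trans (h _ _)
    change S₀ (MaxTensor.map α' β' (.tmul _ _)) = S _
    rw [MaxTensor.map_tmul, h1 α A α' rfl hα hα', h1 β B β' rfl hβ hβ',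
      hS₀.2 _ (hl.map ρ.injective), hS.2 l hl, List.map_map]
    refine congrArg List.prod (List.map_congr_left fun x _ => ?_)
    simp only [Function.comp, Equiv.symm_apply_apply]
    cases x with
    | none => exact hρ' _ _
    | some i => exact congrArg (expect · _ _) (hρ i)
  have h2 : MaxTensor.map (optionHom I d) (optionHom I d) (MaxTensor.congr α β X) =
      MaxTensor.map α' β' (MaxTensor.map (optionHom I d) (optionHom I d) X) := by
    have : (MaxTensor.map (optionHom I d) (optionHom I d)).comp
        (MaxTensor.map (α : _ →⋆ₐ[ℂ] MaxTensor (SpinAlg I d) (Mat d))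
          (β : _ →⋆ₐ[ℂ] MaxTensor (SpinAlg I d) (Mat d))) =
        (MaxTensor.map α' β').comp (MaxTensor.map (optionHom I d) (optionHom I d)) :=
      MaxTensor.hom_ext fun a b => by
        simp [MaxTensor.map_tmul, α', β', optionHom, Θ]
    exact DFunLike.congr_fun this X
  rw [AbstractState.comp_apply, AbstractState.comp_apply, h2]
  exact DFunLike.congr_fun hkey _

/-- The automorphism that permutes the sites. -/
def permEquiv (e : Equiv.Perm I) : SpinAlg I d ≃⋆ₐ[ℂ] SpinAlg I d :=
  StarAlgEquiv.ofStarAlgHom (relabel e e.injective) (relabel e.symm e.symm.injective)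
    (hom_ext fun i m => by simp [relabel_site]) (hom_ext fun i m => by simp [relabel_site])

theorem permEquiv_site (e : Equiv.Perm I) (i : I) (m : Mat d) :
    permEquiv e (site i m) = site (e i) m := relabel_site _ _ _ _

end SpinAlg

/-! ### Shift and swap -/

section Protocol

variable {n : ℕ}

open SpinAlg

open Classical in
/-- The permutation of the sites that shifts the chain `q`. -/
def shiftPerm (q : schmidtVectors n) : Equiv.Perm (Site n) where
  toFun x := if x.1 = q then (x.1, x.2 + 1) else x
  invFun x := if x.1 = q then (x.1, x.2 - 1) else x
  left_inv x := by
    by_cases h : x.1 = q <;> simp [h]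
    rw [← h]
  right_inv x := by
    by_cases h : x.1 = q <;> simp [h]
    rw [← h]

theorem shiftPerm_self (q : schmidtVectors n) (j : ℤ) : shiftPerm q (q, j) = (q, j + 1) :=
  if_pos rfl

theorem shiftPerm_of_ne {q p : schmidtVectors n} (h : p ≠ q) (j : ℤ) :
    shiftPerm q (p, j) = (p, j) := if_neg h

/-- The shift automorphism. -/
def shiftEquiv (q : schmidtVectors n) : Register n ≃⋆ₐ[ℂ] Register n := permEquiv (shiftPerm q)

theorem isShift_shiftEquiv (q : schmidtVectors n) : IsShift q (shiftEquiv q) := by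
  refine ⟨fun j m => ?_, fun p hp j m => ?_⟩
  · rw [shiftEquiv, permEquiv_site, shiftPerm_self]
  · rw [shiftEquiv, permEquiv_site, shiftPerm_of_ne hp]

open Classical in
/-- The permutation of the sites that exchanges the external site with `(q, 0)`. -/
def swapPerm (q : schmidtVectors n) : Equiv.Perm (Option (Site n)) :=
  Equiv.swap none (some (q, 0))

/-- The swap automorphism. -/
def swapEquiv (q : schmidtVectors n) :
    MaxTensor (Register n) (Mat (2 ^ n)) ≃⋆ₐ[ℂ] MaxTensor (Register n) (Mat (2 ^ n)) :=
  ((optionEquiv (Site n) (2 ^ n)).symm.trans (permEquiv (swapPerm q))).trans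
    (optionEquiv (Site n) (2 ^ n))

theorem swapEquiv_optionEquiv (q : schmidtVectors n) (x : Option (Site n)) (m : Mat (2 ^ n)) :
    swapEquiv q (optionEquiv _ _ (site x m)) = optionEquiv _ _ (site (swapPerm q x) m) := by
  rw [swapEquiv, StarAlgEquiv.trans_apply, StarAlgEquiv.trans_apply,
    StarAlgEquiv.symm_apply_apply, permEquiv_site]

theorem swapPerm_of_ne {q : schmidtVectors n} {x : Site n} (h : x ≠ (q, 0)) :
    swapPerm q (some x) = some x :=
  Equiv.swap_apply_of_ne_of_ne (by simp) (by simpa using h)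

theorem isSwap_swapEquiv (q : schmidtVectors n) : IsSwap q (swapEquiv q) := by
  refine ⟨fun m => ?_, fun m => ?_, fun x hx m => ?_⟩
  · rw [← optionEquiv_some, ← optionEquiv_none, swapEquiv_optionEquiv, swapPerm,
      Equiv.swap_apply_right]
  · rw [← optionEquiv_some, ← optionEquiv_none, swapEquiv_optionEquiv, swapPerm,
      Equiv.swap_apply_left]
  · rw [← optionEquiv_some, swapEquiv_optionEquiv, swapPerm_of_ne hx]

theorem congr_shiftEquiv_optionEquiv (q : schmidtVectors n) (x : Option (Site n))
    (m : Mat (2 ^ n)) :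
    MaxTensor.congr (shiftEquiv q) (StarAlgEquiv.refl ℂ (Mat (2 ^ n)))
      (optionEquiv _ _ (site x m)) =
        optionEquiv _ _ (site (Equiv.optionCongr (shiftPerm q) x) m) := by
  cases x with
  | none =>
    rw [optionEquiv_none, MaxTensor.congr_tmul, map_one, Equiv.optionCongr_apply, Option.map_none,
      optionEquiv_none]
    rfl
  | some x =>
    rw [optionEquiv_some, MaxTensor.congr_tmul, map_one, Equiv.optionCongr_apply, Option.map_some,
      optionEquiv_some, shiftEquiv, permEquiv_site]

theorem shiftAfterSwap_optionEquiv (q : schmidtVectors n) (x : Option (Site n))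
    (m : Mat (2 ^ n)) :
    shiftAfterSwap (shiftEquiv q) (swapEquiv q) (optionEquiv _ _ (site x m)) =
      optionEquiv _ _ (site ((swapPerm q).trans (Equiv.optionCongr (shiftPerm q)) x) m) := by
  rw [shiftAfterSwap, StarAlgEquiv.trans_apply, swapEquiv_optionEquiv,
    congr_shiftEquiv_optionEquiv, Equiv.trans_apply]

theorem norm_schmidtVectors (q : schmidtVectors n) : ‖q.1‖ = 1 := by
  refine (sq_eq_sq₀ (norm_nonneg _) zero_le_one).1 ?_
  rw [EuclideanSpace.norm_sq_eq, one_pow, ← q.2.2.2]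
  exact Finset.sum_congr rfl fun i _ => by rw [Real.norm_eq_abs, sq_abs]

theorem norm_siteState (x : Site n) : ‖siteState x‖ = 1 := by
  rw [siteState]
  split_ifs
  · exact norm_ket00
  · rw [norm_schmidtState, norm_schmidtVectors]

/-- The state along the chain `q` changes only between positions `0` and `1`; that single defect is
what the swap repairs. -/
theorem siteState_shiftPerm {q : schmidtVectors n} {x : Site n} (h : x ≠ (q, 0)) :
    siteState (shiftPerm q x) = siteState x := by
  obtain ⟨p, j⟩ := x
  by_cases hp : p = q
  · subst hp
    have hj : j ≠ 0 := fun hj => h (by rw [hj])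
    rw [shiftPerm_self, siteState, siteState]
    have : j + 1 ≤ 0 ↔ j ≤ 0 := by omega
    simp only [this]
  · rw [shiftPerm_of_ne hp]

theorem exists_catalyst (n : ℕ) :
    ∃ s : AbstractState (MaxTensor (Register n) (Register n)), IsCatalyst s ∧
      ∀ q : schmidtVectors n, ∃ σ τ, IsShift q σ ∧ IsSwap q τ ∧
        Embezzles s (shiftAfterSwap σ τ) (shiftAfterSwap σ τ) (schmidtState q.1) ∧
        ∀ U V : unitary (Mat (2 ^ n)),
          Embezzles s ((externalUnitary (Register n) U).trans (shiftAfterSwap σ τ))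
            ((externalUnitary (Register n) V).trans (shiftAfterSwap σ τ))
            (localUnitary U V (schmidtState q.1)) := by
  obtain ⟨s, hs⟩ := exists_productState (siteState (n := n)) norm_siteState
  refine ⟨s, hs.2, fun q => ⟨shiftEquiv q, swapEquiv q, isShift_shiftEquiv q, isSwap_swapEquiv q,
    ?_⟩⟩
  let ρ : Equiv.Perm (Option (Site n)) := (swapPerm q).trans (Equiv.optionCongr (shiftPerm q))
  have hα : ∀ x m, shiftAfterSwap (shiftEquiv q) (swapEquiv q) (.tmul (site x m) 1) =
      optionEquiv _ _ (site (ρ (some x)) m) := fun x m => by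
    rw [← optionEquiv_some, shiftAfterSwap_optionEquiv]
  have hα' : ∀ m, shiftAfterSwap (shiftEquiv q) (swapEquiv q) (.tmul 1 m) =
      optionEquiv _ _ (site (ρ none) m) := fun m => by
    rw [← optionEquiv_none, shiftAfterSwap_optionEquiv]
  -- At `(q, 0)` the permutation leads to the external site, whose initial |00⟩ agrees with the
  -- catalyst there; elsewhere it is a shift that preserves the state.
  have hρ : ∀ x, Option.elim (ρ (some x)) (ket00 (2 ^ n)) siteState = siteState x := by
    intro x
    by_cases hx : x = (q, 0)
    · subst hx
      have : ρ (some (q, 0)) = none := by simp [ρ, swapPerm]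
      rw [this, siteState, if_pos le_rfl]
      rfl
    · have : ρ (some x) = some (shiftPerm q x) := by simp [ρ, swapPerm_of_ne hx]
      rw [this, ← siteState_shiftPerm hx]
      rfl
  -- The external site lands at `(q, 1)`, where |φ_q⟩ is waiting.
  have hρ' : Option.elim (ρ none) (ket00 (2 ^ n)) siteState = schmidtState q.1 := by
    have : ρ none = some (q, 1) := by simp [ρ, swapPerm, shiftPerm_self]
    rw [this, Option.elim_some, siteState, if_neg (show ¬(1 : ℤ) ≤ 0 by norm_num)]
  have hq : ‖schmidtState q.1‖ = 1 := by rw [norm_schmidtState, norm_schmidtVectors]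
  refine ⟨IsProductState.embezzles hs norm_siteState hq ρ id id _ _ hα hα' hα hα' hρ
    (fun m m' => by rw [hρ']; rfl), fun U V => ?_⟩
  have hU : ∀ (U : unitary (Mat (2 ^ n))) x m,
      ((externalUnitary (Register n) U).trans (shiftAfterSwap (shiftEquiv q) (swapEquiv q)))
        (.tmul (site x m) 1) = optionEquiv _ _ (site (ρ (some x)) m) := by
    intro U x m
    rw [StarAlgEquiv.trans_apply, externalUnitary, MaxTensor.congr_tmul, map_one]
    exact hα x m
  have hU' : ∀ (U : unitary (Mat (2 ^ n))) m,
      ((externalUnitary (Register n) U).trans (shiftAfterSwap (shiftEquiv q) (swapEquiv q)))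
        (.tmul 1 m) = optionEquiv _ _ (site (ρ none)
          (Unitary.conjStarAlgAut ℂ (Mat (2 ^ n)) U⁻¹ m)) := by
    intro U m
    rw [StarAlgEquiv.trans_apply, externalUnitary, MaxTensor.congr_tmul, map_one]
    exact hα' _
  exact IsProductState.embezzles hs norm_siteState (by rw [norm_localUnitary, hq]) ρ _ _ _ _
    (hU U) (hU' U) (hU V) (hU' V) hρ (fun m m' => by rw [hρ', expect_localUnitary])

end Protocol

/-! ### Density of the Schmidt vectors and of the target states -/

section Density

variable {n : ℕ}

/-- Positivity makes the vector recoverable from its rational squares, of which there are countably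
many choices. -/
theorem countable_schmidtVectors (n : ℕ) : (schmidtVectors n).Countable := by
  choose r hr using fun q : schmidtVectors n => q.2.2.1
  have hinj : Function.Injective r := by
    intro q p h
    refine Subtype.ext (PiLp.ext fun i => ?_)
    have h1 : (q.1 i) ^ 2 = (p.1 i) ^ 2 := by rw [hr q i, hr p i, h]
    exact (sq_eq_sq₀ (q.2.1 i).le (p.2.1 i).le).1 h1
  exact Set.countable_coe_iff.1 hinj.countable

theorem closure_schmidtVectors (n : ℕ) :
    closure (schmidtVectors n) = {q | (∀ i, 0 ≤ q i) ∧ ‖q‖ = 1} := by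
  refine Set.Subset.antisymm (closure_minimal (fun q hq => ⟨fun i => (hq.1 i).le,
    norm_schmidtVectors ⟨q, hq⟩⟩) ?_) ?_
  · have h1 : IsClosed {q : EuclideanSpace ℝ (Fin (2 ^ n)) | ∀ i, 0 ≤ q i} := by
      simp only [Set.ofPred_forall]
      exact isClosed_iInter fun i => isClosed_le continuous_const (by fun_prop)
    exact h1.inter (isClosed_eq continuous_norm continuous_const)
  · rintro q ⟨hq, hq1⟩
    -- Approximating the squares strictly from above keeps them positive even where `q i = 0`.
    -- Dividing by their rational sum, which tends to `1`, restores the normalization.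
    choose u _ hu hlim using fun i => Real.exists_seq_rat_strictAnti_tendsto (q i ^ 2)
    have hpos : ∀ k i, 0 < (u i k : ℝ) := fun k i => (sq_nonneg _).trans_lt (hu i k)
    have hsum : ∀ k, 0 < ∑ i, (u i k : ℝ) := fun k =>
      Finset.sum_pos (fun i _ => hpos k i) Finset.univ_nonempty
    have hq2 : ∑ i, q i ^ 2 = 1 := by
      have := EuclideanSpace.norm_sq_eq q
      rw [hq1, one_pow] at this
      rw [this]
      exact Finset.sum_congr rfl fun i _ => by rw [Real.norm_eq_abs, sq_abs]
    let v : ℕ → EuclideanSpace ℝ (Fin (2 ^ n)) := fun k =>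
      WithLp.toLp 2 fun i => √((u i k : ℝ) / ∑ j, (u j k : ℝ))
    have hv : ∀ k, v k ∈ schmidtVectors n := by
      intro k
      have h2 : ∀ i, (v k i) ^ 2 = (u i k : ℝ) / ∑ j, (u j k : ℝ) := fun i =>
        Real.sq_sqrt (div_pos (hpos k i) (hsum k)).le
      refine ⟨fun i => Real.sqrt_pos.2 (div_pos (hpos k i) (hsum k)),
        fun i => ⟨u i k / ∑ j, u j k, by rw [h2]; push_cast; rfl⟩, ?_⟩
      simp only [h2]
      rw [← Finset.sum_div, div_self (hsum k).ne']
    refine mem_closure_of_tendsto (f := v) (b := Filter.atTop) ?_ (Filter.Eventually.of_forall hv)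
    have hs : Filter.Tendsto (fun k => ∑ j, (u j k : ℝ)) Filter.atTop (nhds 1) := by
      rw [← hq2]
      exact tendsto_finsetSum _ fun i _ => hlim i
    have h3 : Filter.Tendsto (fun k i => √((u i k : ℝ) / ∑ j, (u j k : ℝ))) Filter.atTop
        (nhds q.ofLp) := by
      refine tendsto_pi_nhds.2 fun i => ?_
      have := ((hlim i).div hs one_ne_zero).sqrt
      rwa [div_one, Real.sqrt_sq (hq i)] at this
    exact ((PiLp.continuous_toLp 2 _).tendsto _).comp h3

/-- The Schmidt decomposition of a two-party state. -/
theorem exists_schmidt_decomposition (φ : Bipartite (2 ^ n)) :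
    ∃ (q : EuclideanSpace ℝ (Fin (2 ^ n))) (U V : unitary (Mat (2 ^ n))), (∀ i, 0 ≤ q i) ∧
      φ = localUnitary U V (schmidtState q) := by
  let A : Matrix (Fin (2 ^ n)) (Fin (2 ^ n)) ℂ := fun j k => φ (j, k)
  have hA : (A.conjTranspose * A).IsHermitian := Matrix.isHermitian_conjTranspose_mul_self A
  let W : Matrix (Fin (2 ^ n)) (Fin (2 ^ n)) ℂ := hA.eigenvectorUnitary
  have hW : W.conjTranspose * W = 1 := Unitary.coe_star_mul_self hA.eigenvectorUnitary
  have hW' : W * W.conjTranspose = 1 := Unitary.coe_mul_star_self hA.eigenvectorUnitary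
  -- Singular value decomposition: with `W` diagonalizing `A* A`, the columns of `A * W` are
  -- orthogonal, and their norms are the Schmidt coefficients.
  have hdiag : (A * W).conjTranspose * (A * W) =
      Matrix.diagonal (fun i => (hA.eigenvalues i : ℂ)) := by
    have h : W.conjTranspose * (A.conjTranspose * A) * W =
        Matrix.diagonal (fun i => (hA.eigenvalues i : ℂ)) :=
      (Unitary.conjStarAlgAut_star_apply (S := ℂ) hA.eigenvectorUnitary _).symm.trans
        hA.conjStarAlgAut_star_eigenvectorUnitary
    rw [← h, Matrix.conjTranspose_mul]
    simp only [Matrix.mul_assoc]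
  let w : Fin (2 ^ n) → EuclideanSpace ℂ (Fin (2 ^ n)) := fun i =>
    WithLp.toLp 2 fun a => (A * W) a i
  have hw : ∀ i j, i ≠ j → inner ℂ (w i) (w j) = 0 := by
    intro i j hij
    have h := congrFun (congrFun hdiag i) j
    rw [Matrix.diagonal_apply_ne _ hij, Matrix.mul_apply] at h
    rw [PiLp.inner_apply, ← h]
    exact Finset.sum_congr rfl fun a _ => mul_comm _ _
  -- Only nonzero columns can be normalized; the unitary `U` is completed arbitrarily on the others,
  -- which have coefficient `0`.
  let s : Set (Fin (2 ^ n)) := {i | ‖w i‖ ≠ 0}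
  obtain ⟨U, hU⟩ := exists_unitary_of_orthonormal (fun i => ((‖w i‖ : ℂ))⁻¹ • w i) s
    ⟨fun i => by
      have hi : ‖w i‖ ≠ 0 := i.2
      rw [Set.domRestrict_apply, norm_smul, norm_inv, Complex.norm_real, norm_norm,
        inv_mul_cancel₀ hi],
    fun i j hij => by
      change inner ℂ ((‖w i‖ : ℂ)⁻¹ • w i) ((‖w j‖ : ℂ)⁻¹ • w j) = 0
      rw [inner_smul_left, inner_smul_right, hw i j (fun h => hij (Subtype.ext h)), mul_zero,
        mul_zero]⟩
  have hU' : ∀ a i, (U : Mat (2 ^ n)) a i * (‖w i‖ : ℂ) = (A * W) a i := by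
    intro a i
    by_cases hi : ‖w i‖ = 0
    · have h0 : w i = 0 := norm_eq_zero.1 hi
      have h1 : (A * W) a i = w i a := rfl
      rw [hi, h1, h0]
      simp
    · have hi' : (‖w i‖ : ℂ) ≠ 0 := by exact_mod_cast hi
      rw [hU i hi a, PiLp.smul_apply, smul_eq_mul, mul_right_comm, inv_mul_cancel₀ hi', one_mul]
  have hs : W.conjTranspose.transpose.conjTranspose = W.transpose := by
    ext i j
    simp
  -- `V` is the entrywise conjugate of `W`: the matrix of coefficients is `U D W*`, and the second
  -- tensor factor acts through a transpose.
  let V : unitary (Mat (2 ^ n)) := ⟨CStarMatrix.ofMatrix W.conjTranspose.transpose,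
    Unitary.mem_iff.2 ⟨by
      have h := congrArg Matrix.transpose hW
      rw [Matrix.transpose_mul, Matrix.transpose_one, ← hs] at h
      exact h, by
      have h := congrArg Matrix.transpose hW'
      rw [Matrix.transpose_mul, Matrix.transpose_one, ← hs] at h
      exact h⟩⟩
  refine ⟨WithLp.toLp 2 fun i => ‖w i‖, U, V, fun i => norm_nonneg _, PiLp.ext fun x => ?_⟩
  have h1 : φ x = ((A * W) * W.conjTranspose) x.1 x.2 := by
    rw [Matrix.mul_assoc, hW', Matrix.mul_one]
  rw [h1, Matrix.mul_apply]
  change _ = ∑ y : Fin (2 ^ n) × Fin (2 ^ n),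
    (U : Mat (2 ^ n)) x.1 y.1 * (V : Mat (2 ^ n)) x.2 y.2 * (if y.1 = y.2 then ((‖w y.1‖ : ℝ) : ℂ) else 0)
  rw [Fintype.sum_prod_type]
  refine Finset.sum_congr rfl fun i _ => ?_
  rw [← hU']
  simp only [mul_ite, mul_zero, Finset.sum_ite_eq, Finset.mem_univ, if_true]
  exact mul_right_comm _ _ _

theorem continuous_localUnitary_schmidtState (U V : unitary (Mat (2 ^ n))) :
    Continuous fun q : EuclideanSpace ℝ (Fin (2 ^ n)) => localUnitary U V (schmidtState q) := by
  refine (PiLp.continuous_toLp 2 _).comp (continuous_pi fun x => ?_)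
  refine continuous_finsetSum _ fun y _ => continuous_const.mul ?_
  have : Continuous fun q : EuclideanSpace ℝ (Fin (2 ^ n)) =>
      if y.1 = y.2 then ((q y.1 : ℝ) : ℂ) else 0 := by
    split_ifs <;> fun_prop
  exact this

/-- For fixed local unitaries the target depends continuously on `q`, so approximating the Schmidt
coefficients alone already approximates the vector. -/
theorem closure_targetStates (n : ℕ) : closure (targetStates n) = Metric.sphere 0 1 := by
  refine Set.Subset.antisymm (closure_minimal ?_ Metric.isClosed_sphere) ?_
  · rintro _ ⟨q, hq, U, V, rfl⟩
    rw [mem_sphere_zero_iff_norm, norm_localUnitary, norm_schmidtState]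
    exact norm_schmidtVectors ⟨q, hq⟩
  · intro φ hφ
    obtain ⟨q, U, V, hq, rfl⟩ := exists_schmidt_decomposition φ
    rw [mem_sphere_zero_iff_norm, norm_localUnitary, norm_schmidtState] at hφ
    have h : q ∈ closure (schmidtVectors n) := by
      rw [closure_schmidtVectors]
      exact ⟨hq, hφ⟩
    refine map_mem_closure (f := fun q => localUnitary U V (schmidtState q))
      (continuous_localUnitary_schmidtState U V) h fun p hp => ?_
    exact ⟨p, hp, U, V, rfl⟩

theorem nonempty_schmidtVectors (n : ℕ) : (schmidtVectors n).Nonempty := by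
  rw [← closure_nonempty_iff, closure_schmidtVectors]
  refine ⟨EuclideanSpace.single 0 1, fun i => ?_, ?_⟩
  · rw [EuclideanSpace.single, PiLp.single_apply]
    split_ifs <;> norm_num
  · rw [EuclideanSpace.single, PiLp.norm_single, norm_one]

end Density

end

theorem theorem2 (n : ℕ) (hn : 1 ≤ n) :
    (schmidtVectors n).Countable ∧
    closure (schmidtVectors n) = {q | (∀ i, 0 ≤ q i) ∧ ‖q‖ = 1} ∧
    closure (targetStates n) = Metric.sphere 0 1 ∧
    Nonempty (Register n ≃⋆ₐ[ℂ] CAR) ∧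
    Nonempty (MaxTensor (Register n) (Register n) ≃⋆ₐ[ℂ] CAR) ∧
    ∃ s : AbstractState (MaxTensor (Register n) (Register n)), IsCatalyst s ∧
      ∀ q : schmidtVectors n, ∃ σ τ, IsShift q σ ∧ IsSwap q τ ∧
        Embezzles s (shiftAfterSwap σ τ) (shiftAfterSwap σ τ) (schmidtState q.1) ∧
        ∀ U V : unitary (Mat (2 ^ n)),
          Embezzles s ((externalUnitary (Register n) U).trans (shiftAfterSwap σ τ))
            ((externalUnitary (Register n) V).trans (shiftAfterSwap σ τ))
            (localUnitary U V (schmidtState q.1)) := by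
  have : Countable (schmidtVectors n) := countable_schmidtVectors n
  have : Nonempty (schmidtVectors n) := (nonempty_schmidtVectors n).to_subtype
  -- The sites of both parties together form another countably infinite set, which handles the
  -- tensor square.
  obtain ⟨e⟩ := SpinAlg.nonempty_equiv_car (K := Site n ⊕ Site n) hn
  exact ⟨countable_schmidtVectors n, closure_schmidtVectors n, closure_targetStates n,
    SpinAlg.nonempty_equiv_car hn, ⟨(SpinAlg.sumEquiv (Site n) (Site n) (2 ^ n)).symm.trans e⟩,
    exists_catalyst n⟩
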